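/- A bipartite graph $G=(A,B,\mathcal E)$ has a top part $A$, a bottom part $B$ and an edge set $\mathcal E\subseteq A\times B$; graphs are finite. For $S\subseteq A$ and $T\subseteq B$ let $G[S,T]=(S,T,\mathcal E\cap(S\times T))$, and let $\overline{G}^{bip}=(A,B,(A\times B)\setminus\mathcal E)$ be the bipartite complement. For bipartite graphs $G,H$ say that $G$ is $H$-free if no induced subgraph of $G$ is isomorphic to $H$ by an isomorphism that respects the bipartition (top to top, bottom to bottom). Let $\Lambda_k$ be the star with its centre in the top part and its $k$ leaves in the bottom part, let $V_k$ be the star with its centre in the bottom part and its $k$ leaves in the top part, and let $nH$ be the disjoint union of $n$ copies of $H$, its top part being the union of the top parts and its bottom part the union of the bottom parts of the copies. **Theorem.** There is a function $U:\mathbb N\times\mathbb N\to\mathbb N$ such that the following holds for all integers $k\ge 1$ and $n',n'',m',m''\ge 0$, with $\mu=n'+n''+m'+m''$. Let $G=(A,B,\mathcal E)$ be a finite bipartite graph that is $n'V_k$-free, $n''\Lambda_k$-free, $\overline{m'V_k}^{bip}$-free and $\overline{m''\Lambda_k}^{bip}$-free. Then there are an integer $u\le U(\mu,k)$ and partitions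 $A=A_1\cup\dots\cup A_u$ and $B=B_1\cup\dots\cup B_u$ into pairwise disjoint, possibly empty, sets such that for all $1\le i,j\le u$ the bipartite graph $G[A_i,B_j]$ is both $2\Lambda_{2k-1}$-free and $2V_{2k-1}$-free. -/

import Mathlib

universe u v

/-- A bipartite graph `(A, B, E)` with top part `A`, bottom part `B` (disjoint by construction, being
two separate types) and edge set `E ⊆ A × B`. -/
structure BipartiteGraph (A : Type u) (B : Type v) where
  /-- The edge set. -/
  edges : Set (A × B)

namespace BipartiteGraph

universe u' v'

variable {A : Type u} {B : Type v} {C : Type u'} {D : Type v'}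

/-- `G.Contains H`: `H` is isomorphic to an induced subgraph of `G`, through an embedding that sends
the top part of `H` into the top part of `G` and the bottom part into the bottom part. -/
def Contains (G : BipartiteGraph A B) (H : BipartiteGraph C D) : Prop :=
  ∃ (f : C ↪ A) (g : D ↪ B), ∀ c d, (f c, g d) ∈ G.edges ↔ (c, d) ∈ H.edges

/-- `G` is `H`-free. -/
def Free (G : BipartiteGraph A B) (H : BipartiteGraph C D) : Prop :=
  ¬ G.Contains H

/-- The bipartite complement: same parts, edge set `(A × B) \ E`. -/
def bipCompl (G : BipartiteGraph A B) : BipartiteGraph A B where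
  edges := G.edgesᶜ

/-- The bipartite graph `G[S, T]` induced by `S ⊆ A` and `T ⊆ B`. -/
def induce (G : BipartiteGraph A B) (S : Set A) (T : Set B) : BipartiteGraph S T where
  edges := {p | ((p.1 : A), (p.2 : B)) ∈ G.edges}

/-- The disjoint union `n H` of `n` copies of `H`. -/
def copies (n : ℕ) (H : BipartiteGraph C D) : BipartiteGraph (Fin n × C) (Fin n × D) where
  edges := {p | p.1.1 = p.2.1 ∧ (p.1.2, p.2.2) ∈ H.edges}

/-- The star `Λ_k`: one centre in the top part joined to `k` leaves in the bottom part. -/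
def starΛ (k : ℕ) : BipartiteGraph Unit (Fin k) where
  edges := Set.univ

/-- The star `V_k`: one centre in the bottom part joined to `k` leaves in the top part. -/
def starV (k : ℕ) : BipartiteGraph (Fin k) Unit where
  edges := Set.univ

end BipartiteGraph

/-- The sets `P 0, …, P (m - 1)` partition `X`: they are pairwise disjoint and cover `X`. Some of them
may be empty, which lets the two sides of a bipartite graph have equally many parts. -/
def IsIndexedPartition {X : Type u} {m : ℕ} (P : Fin m → Set X) : Prop :=
  Pairwise (fun i j => Disjoint (P i) (P j)) ∧ ⋃ i, P i = Set.univ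

/-! Call a set of tops a near-chain if, of any two neighbourhoods, one is contained in the other up
to fewer than `K` elements. This is freeness from two disjoint stars with `K` leaves, and it
survives complementation. The proof has two layers.

The size of the threshold hardly matters. If the bottoms form a near-chain with any threshold `K`,
then the tops split into boundedly many near-chains with threshold `2 * k - 1`
(`exists_sharp_colouring`): sort the bottoms by degree; each top is disordered only on an interval,
few intervals share a point, and tops with disjoint intervals are comparable. Refining bottoms and
then tops in this way turns a one-sided colouring with some bounded threshold into the required
partition (`exists_two_sided_colouring`).

The one-sided colouring (`bounded`) comes from induction on the four star numbers, for all `k` at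
once. Call a pair of vertex sets large if it has no good colouring with a prescribed number of
colours. By induction a large pair contains, for each of the four types, a family of stars with one
star fewer than the forbidden family and with many more leaves, so one further compatible star is a
contradiction. This rigidity arranges large pairs linearly: relative to a family of stars (a frame),
a large pair has a large part wholly after it or wholly before it, and extremal frames produce two
large pairs in the relation `Before` (`Scale.exists_before`). In a longest chain of large pairs
every vertex has a position. Vertices at far positions span an almost empty or almost complete
graph, while a very large pair at near positions would allow a longer chain
(`Scale.exists_positions`). So near positions have good colourings, and these are glued along the
positions modulo 3 (`good_of_positions`). -/

section

open scoped Classical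

namespace BipartiteGraph

universe u' v'

variable {A : Type u} {B : Type v} {C : Type u'} {D : Type v'}

/-! ### Induced disjoint unions of stars -/

/-- The complementary relation. -/
def co (E : A → B → Prop) : A → B → Prop := fun a b => ¬ E a b

theorem co_co (E : A → B → Prop) : co (co E) = E := by
  funext a b; simp [co]

/-- `Stars E k n X Y`: there are `n` centres in `X` and `n` sets of `k` leaves in `Y` which induce a
disjoint union of `n` stars in the bipartite graph of the relation `E`. -/
def Stars (E : A → B → Prop) (k : ℕ) : ℕ → Finset A → Finset B → Prop
  | 0, _, _ => True
  | n + 1, X, Y => ∃ a ∈ X, ∃ P ⊆ Y, P.card = k ∧ (∀ y ∈ P, E a y) ∧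
      Stars E k n (X.filter fun x => ∀ y ∈ P, ¬ E x y) (Y.filter fun y => ¬ E a y)

theorem Stars.mono {E : A → B → Prop} {k n : ℕ} {X X' : Finset A} {Y Y' : Finset B}
    (h : Stars E k n X Y) (hX : X ⊆ X') (hY : Y ⊆ Y') : Stars E k n X' Y' := by
  induction n generalizing X X' Y Y' with
  | zero => trivial
  | succ n ih =>
    obtain ⟨a, ha, P, hP, hc, hE, hs⟩ := h
    exact ⟨a, hX ha, P, hP.trans hY, hc, hE,
      ih hs (Finset.filter_subset_filter _ hX) (Finset.filter_subset_filter _ hY)⟩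

theorem Stars.mono_leaves {E : A → B → Prop} {k k' n : ℕ} {X : Finset A} {Y : Finset B}
    (h : Stars E k' n X Y) (hk : k ≤ k') : Stars E k n X Y := by
  induction n generalizing X Y with
  | zero => trivial
  | succ n ih =>
    obtain ⟨a, ha, P, hP, hc, hE, hs⟩ := h
    obtain ⟨Q, hQ, hQc⟩ := Finset.exists_subset_card_eq (hc ▸ hk : k ≤ P.card)
    refine ⟨a, ha, Q, hQ.trans hP, hQc, fun y hy => hE y (hQ hy), ih (hs.mono ?_ subset_rfl)⟩
    intro x hx
    rw [Finset.mem_filter] at hx ⊢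
    exact ⟨hx.1, fun y hy => hx.2 y (hQ hy)⟩

theorem Stars.of_succ {E : A → B → Prop} {k n : ℕ} {X : Finset A} {Y : Finset B}
    (h : Stars E k (n + 1) X Y) : Stars E k n X Y := by
  obtain ⟨a, ha, P, hP, hc, hE, hs⟩ := h
  exact hs.mono (Finset.filter_subset _ _) (Finset.filter_subset _ _)

theorem Stars.mono_copies {E : A → B → Prop} {k n n' : ℕ} {X : Finset A} {Y : Finset B}
    (h : Stars E k n' X Y) (hn : n ≤ n') : Stars E k n X Y := by
  induction hn with
  | refl => exact h
  | step _ ih => exact ih h.of_succ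

theorem Stars.map {E : A → B → Prop} {k n : ℕ} (f : C → A) (g : D ↪ B)
    {X : Finset C} {Y : Finset D} {X' : Finset A} {Y' : Finset B}
    (hX : ∀ x ∈ X, f x ∈ X') (hY : ∀ y ∈ Y, g y ∈ Y')
    (h : Stars (fun a b => E (f a) (g b)) k n X Y) : Stars E k n X' Y' := by
  induction n generalizing X Y X' Y' with
  | zero => trivial
  | succ n ih =>
    obtain ⟨a, ha, P, hP, hc, hE, hs⟩ := h
    refine ⟨f a, hX a ha, P.map g, ?_, by simpa using hc, by simpa using hE, ih ?_ ?_ hs⟩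
    · intro y hy
      obtain ⟨z, hz, rfl⟩ := Finset.mem_map.1 hy
      exact hY z (hP hz)
    · intro x hx
      rw [Finset.mem_filter] at hx ⊢
      exact ⟨hX x hx.1, by simpa using hx.2⟩
    · intro y hy
      rw [Finset.mem_filter] at hy ⊢
      exact ⟨hY y hy.1, hy.2⟩

/-- The centres `a i` and the leaf sets `P i` induce `n` disjoint stars with `k` leaves. -/
structure IsFrame (E : A → B → Prop) (k n : ℕ) (X : Finset A) (Y : Finset B)
    (a : Fin n → A) (P : Fin n → Finset B) : Prop where
  mem : ∀ i, a i ∈ X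
  sub : ∀ i, P i ⊆ Y
  card : ∀ i, (P i).card = k
  adj : ∀ i, ∀ y ∈ P i, E (a i) y
  not_adj : ∀ i j, i ≠ j → ∀ y ∈ P i, ¬ E (a j) y

theorem Stars.exists_isFrame {E : A → B → Prop} {k n : ℕ} {X : Finset A} {Y : Finset B}
    (h : Stars E k n X Y) : ∃ a P, IsFrame E k n X Y a P := by
  induction n generalizing X Y with
  | zero => exact ⟨Fin.elim0, Fin.elim0, ⟨fun i => i.elim0, fun i => i.elim0, fun i => i.elim0,
      fun i => i.elim0, fun i => i.elim0⟩⟩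
  | succ n ih =>
    obtain ⟨a, ha, P, hP, hc, hE, hs⟩ := h
    obtain ⟨b, Q, hF⟩ := ih hs
    refine ⟨Fin.cons a b, Fin.cons P Q, ⟨?_, ?_, ?_, ?_, ?_⟩⟩
    · intro i
      refine Fin.cases ha (fun i => ?_) i
      simpa using (Finset.mem_filter.1 (hF.mem i)).1
    · intro i
      refine Fin.cases hP (fun i => ?_) i
      simpa using (hF.sub i).trans (Finset.filter_subset _ _)
    · intro i
      refine Fin.cases hc (fun i => ?_) i
      simpa using hF.card i
    · intro i
      refine Fin.cases hE (fun i => ?_) i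
      simpa using hF.adj i
    · intro i j
      refine Fin.cases ?_ (fun i => ?_) i <;> refine Fin.cases ?_ (fun j => ?_) j
      · simp
      · intro _ y hy
        simpa using (Finset.mem_filter.1 (hF.mem j)).2 y (by simpa using hy)
      · intro _ y hy
        simpa using (Finset.mem_filter.1 (hF.sub i (by simpa using hy))).2
      · intro hij y hy
        simpa using hF.not_adj i j (by simpa using hij) y (by simpa using hy)

theorem IsFrame.stars {E : A → B → Prop} {k n : ℕ} {X : Finset A} {Y : Finset B}
    {a : Fin n → A} {P : Fin n → Finset B} (h : IsFrame E k n X Y a P) : Stars E k n X Y := by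
  induction n generalizing X Y with
  | zero => trivial
  | succ n ih =>
    refine ⟨a 0, h.mem 0, P 0, h.sub 0, h.card 0, h.adj 0,
      ih (a := fun i => a i.succ) (P := fun i => P i.succ) ⟨?_, ?_, ?_, ?_, ?_⟩⟩
    · intro i
      exact Finset.mem_filter.2 ⟨h.mem _, h.not_adj 0 i.succ (Fin.succ_ne_zero i).symm⟩
    · intro i y hy
      exact Finset.mem_filter.2 ⟨h.sub _ hy, h.not_adj i.succ 0 (Fin.succ_ne_zero i) y hy⟩
    · exact fun i => h.card _
    · exact fun i => h.adj _
    · exact fun i j hij => h.not_adj _ _ (by simpa using hij)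

theorem IsFrame.mono {E : A → B → Prop} {k n : ℕ} {X X' : Finset A} {Y Y' : Finset B}
    {a : Fin n → A} {P : Fin n → Finset B} (h : IsFrame E k n X Y a P) (hX : X ⊆ X')
    (hY : Y ⊆ Y') : IsFrame E k n X' Y' a P :=
  ⟨fun i => hX (h.mem i), fun i => (h.sub i).trans hY, h.card, h.adj, h.not_adj⟩

/-! ### Degrees, excesses and near-chains -/

/-- The number of elements of `Y` related to `x`. -/
noncomputable def deg (E : A → B → Prop) (x : A) (Y : Finset B) : ℕ := (Y.filter fun y => E x y).card

theorem deg_mono (E : A → B → Prop) (x : A) {Y Y' : Finset B} (h : Y ⊆ Y') :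
    deg E x Y ≤ deg E x Y' :=
  Finset.card_le_card (Finset.filter_subset_filter _ h)

/-- The number of elements of `Y` related to `x` but not to `x'`. -/
noncomputable def excess (E : A → B → Prop) (x x' : A) (Y : Finset B) : ℕ :=
  (Y.filter fun y => E x y ∧ ¬ E x' y).card

theorem excess_mono (E : A → B → Prop) (x x' : A) {Y Y' : Finset B} (h : Y ⊆ Y') :
    excess E x x' Y ≤ excess E x x' Y' :=
  Finset.card_le_card (Finset.filter_subset_filter _ h)

theorem excess_le_deg (E : A → B → Prop) (x x' : A) (Y : Finset B) :
    excess E x x' Y ≤ deg E x Y :=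
  Finset.card_le_card fun y hy => by
    rw [Finset.mem_filter] at hy ⊢; exact ⟨hy.1, hy.2.1⟩

/-- Any two elements of `X` have nested neighbourhoods in `Y`, up to fewer than `K` elements. -/
def NearChain (E : A → B → Prop) (K : ℕ) (X : Finset A) (Y : Finset B) : Prop :=
  ∀ x ∈ X, ∀ x' ∈ X, excess E x x' Y < K ∨ excess E x' x Y < K

theorem NearChain.mono {E : A → B → Prop} {K K' : ℕ} {X X' : Finset A} {Y Y' : Finset B}
    (h : NearChain E K X' Y') (hX : X ⊆ X') (hY : Y ⊆ Y') (hK : K ≤ K') : NearChain E K' X Y := by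
  intro x hx x' hx'
  rcases h x (hX hx) x' (hX hx') with h | h
  · exact Or.inl (((excess_mono E x x' hY).trans_lt h).trans_le hK)
  · exact Or.inr (((excess_mono E x' x hY).trans_lt h).trans_le hK)

theorem stars_two_of_excess {E : A → B → Prop} {k : ℕ} {X : Finset A} {Y : Finset B} {x x' : A}
    (hx : x ∈ X) (hx' : x' ∈ X) (h : k ≤ excess E x x' Y) (h' : k ≤ excess E x' x Y) :
    Stars E k 2 X Y := by
  obtain ⟨P, hP, hPc⟩ := Finset.exists_subset_card_eq h
  obtain ⟨Q, hQ, hQc⟩ := Finset.exists_subset_card_eq h'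
  have hP' := fun y (hy : y ∈ P) => Finset.mem_filter.1 (hP hy)
  have hQ' := fun y (hy : y ∈ Q) => Finset.mem_filter.1 (hQ hy)
  refine ⟨x, hx, P, fun y hy => (hP' y hy).1, hPc, fun y hy => (hP' y hy).2.1, x',
    Finset.mem_filter.2 ⟨hx', fun y hy => (hP' y hy).2.2⟩, Q,
    fun y hy => Finset.mem_filter.2 ⟨(hQ' y hy).1, (hQ' y hy).2.2⟩, hQc,
    fun y hy => (hQ' y hy).2.1, trivial⟩

theorem excess_co (E : A → B → Prop) (x x' : A) (Y : Finset B) :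
    excess (co E) x x' Y = excess E x' x Y := by
  unfold excess co
  congr 1
  ext y
  simp only [Finset.mem_filter, not_not]
  tauto

/-- Complementing exchanges the two excesses, so the condition is symmetric under it. This lets
conditions on the complement be used for the graph itself. -/
theorem nearChain_co {E : A → B → Prop} {K : ℕ} {X : Finset A} {Y : Finset B} :
    NearChain (co E) K X Y ↔ NearChain E K X Y := by
  simp only [NearChain, excess_co]
  exact ⟨fun h x hx x' hx' => (h x hx x' hx').symm, fun h x hx x' hx' => (h x hx x' hx').symm⟩

theorem nearChain_of_not_stars_two {E : A → B → Prop} {k : ℕ} {X : Finset A} {Y : Finset B}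
    (h : ¬ Stars E k 2 X Y) : NearChain E k X Y := by
  intro x hx x' hx'
  by_contra! hc
  exact h (stars_two_of_excess hx hx' hc.1 hc.2)

/-! ### Extracting disjoint stars when degrees are bounded -/

theorem card_filter_exists_le {E : A → B → Prop} {S : Finset A} {P : Finset B} {k K : ℕ}
    (hP : P.card ≤ k) (h : ∀ y ∈ P, deg (flip E) y S ≤ K) :
    (S.filter fun x => ∃ y ∈ P, E x y).card ≤ k * K := by
  have : (S.filter fun x => ∃ y ∈ P, E x y) = P.biUnion fun y => S.filter fun x => E x y := by
    ext x; simp; tauto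
  rw [this]
  exact (Finset.card_biUnion_le_card_mul _ _ _ h).trans (Nat.mul_le_mul_right _ hP)

/-- If the chosen leaf sets `P x` meet few neighbourhoods, then many tops yield many disjoint
induced stars. -/
theorem stars_of_bounded_degree {E : A → B → Prop} {k K : ℕ} {P : A → Finset B} {Y : Finset B}
    (n : ℕ) (S : Finset A) (hP : ∀ x ∈ S, P x ⊆ Y ∧ (P x).card = k ∧ ∀ y ∈ P x, E x y)
    (hd : ∀ x ∈ S, ∀ y ∈ P x, deg (flip E) y S ≤ K) (hS : n * (2 * (k * K) + 1) ≤ S.card) :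
    Stars E k n S Y := by
  induction n generalizing S Y with
  | zero => trivial
  | succ n ih =>
    have hpos : 0 < S.card := by
      refine lt_of_lt_of_le ?_ hS; positivity
    have hout : ∀ x ∈ S, (S.filter fun x' => ∃ y ∈ P x, E x' y).card ≤ k * K := fun x hx =>
      card_filter_exists_le (hP x hx).2.1.le (hd x hx)
    -- View a conflict as an arc of a digraph on `S`. All degrees in one direction are at most `k *
    -- K`, so by double counting some vertex also has at most `k * K` in the other; keeping its star
    -- discards at most `2 * (k * K)` other candidates.
    have hin : ∃ x ∈ S, (S.filter fun x' => ∃ y ∈ P x', E x y).card ≤ k * K := by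
      by_contra! hc
      have h1 := Finset.sum_card_bipartiteAbove_eq_sum_card_bipartiteBelow (s := S) (t := S)
        (fun x x' => ∃ y ∈ P x', E x y)
      have h2 : ∑ x ∈ S, (S.bipartiteBelow (fun x x' => ∃ y ∈ P x', E x y) x).card
          ≤ S.card * (k * K) := by
        rw [← smul_eq_mul]
        exact Finset.sum_le_card_nsmul _ _ _ hout
      have h3 : S.card * (k * K + 1) ≤
          ∑ x ∈ S, (S.bipartiteAbove (fun x x' => ∃ y ∈ P x', E x y) x).card := by
        rw [← smul_eq_mul]
        exact Finset.card_nsmul_le_sum _ _ _ hc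
      nlinarith
    obtain ⟨x, hx, hxin⟩ := hin
    have hxout := hout x hx
    set S' := S.filter fun x' => (∀ y ∈ P x, ¬ E x' y) ∧ ∀ y ∈ P x', ¬ E x y with hS'
    have hSS' : S' ⊆ S := Finset.filter_subset _ _
    have hcard : S.card ≤ S'.card + (2 * (k * K)) := by
      have : S ⊆ S' ∪ ((S.filter fun x' => ∃ y ∈ P x, E x' y) ∪
          S.filter fun x' => ∃ y ∈ P x', E x y) := by
        intro z hz
        simp only [hS', Finset.mem_union, Finset.mem_filter, hz, true_and]
        by_cases h1 : ∃ y ∈ P x, E z y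
        · exact Or.inr (Or.inl h1)
        · by_cases h2 : ∃ y ∈ P z, E x y
          · exact Or.inr (Or.inr h2)
          · push Not at h1 h2
            exact Or.inl ⟨h1, h2⟩
      have h4 := (Finset.card_le_card this).trans (Finset.card_union_le _ _)
      have h5 := Finset.card_union_le (S.filter fun x' => ∃ y ∈ P x, E x' y)
        (S.filter fun x' => ∃ y ∈ P x', E x y)
      omega
    refine ⟨x, hx, P x, (hP x hx).1, (hP x hx).2.1, (hP x hx).2.2, ?_⟩
    refine (ih (Y := Y.filter fun y => ¬ E x y) S' ?_ ?_ ?_).mono ?_ subset_rfl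
    · intro z hz
      have hz' := Finset.mem_filter.1 hz
      refine ⟨fun y hy => Finset.mem_filter.2 ⟨(hP z hz'.1).1 hy, hz'.2.2 y hy⟩, (hP z hz'.1).2⟩
    · intro z hz y hy
      exact (deg_mono _ _ hSS').trans (hd z (hSS' hz) y hy)
    · rw [Nat.succ_mul] at hS
      omega
    · intro z hz
      have hz' := Finset.mem_filter.1 hz
      exact Finset.mem_filter.2 ⟨hz'.1, hz'.2.1⟩

theorem stars_of_deg {E : A → B → Prop} {k K n : ℕ} {S : Finset A} {Y : Finset B}
    (hk : ∀ x ∈ S, k ≤ deg E x Y) (hd : ∀ y ∈ Y, deg (flip E) y S ≤ K)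
    (hS : n * (2 * (k * K) + 1) ≤ S.card) : Stars E k n S Y := by
  have : ∀ x, ∃ P : Finset B, x ∈ S → P ⊆ Y ∧ P.card = k ∧ ∀ y ∈ P, E x y := by
    intro x
    by_cases hx : x ∈ S
    · obtain ⟨P, hP, hc⟩ := Finset.exists_subset_card_eq (hk x hx)
      exact ⟨P, fun _ => ⟨hP.trans (Finset.filter_subset _ _), hc,
        fun y hy => (Finset.mem_filter.1 (hP hy)).2⟩⟩
    · exact ⟨∅, fun h => absurd h hx⟩
  choose P hP using this
  exact stars_of_bounded_degree n S hP (fun x hx y hy => hd y ((hP x hx).1 hy)) hS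

/-! ### Sharpening the threshold to `2 * k - 1` -/

/-- Greedy colouring of a family of intervals: if every point lies in at most `L` of them, then
`L + 1` colours suffice to make the intervals of the same colour disjoint. -/
theorem exists_interval_colouring {L : ℕ} (pos : B → ℕ) (W : A → Finset B) (S : Finset A)
    (hconv : ∀ x, ∀ a ∈ W x, ∀ b ∈ W x, ∀ c, pos a ≤ pos c → pos c ≤ pos b → c ∈ W x)
    (hL : ∀ b, (S.filter fun x => b ∈ W x).card ≤ L) :
    ∃ f : A → Fin (L + 1), ∀ x ∈ S, ∀ x' ∈ S, x ≠ x' → f x = f x' → Disjoint (W x) (W x') := by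
  have hlo : ∃ lo : A → ℕ, ∀ x, (W x).Nonempty →
      (∃ b ∈ W x, pos b = lo x) ∧ ∀ b ∈ W x, lo x ≤ pos b := by
    refine ⟨fun x => if h : (W x).Nonempty then pos (Finset.exists_min_image (W x) pos h).choose
      else 0, fun x h => ?_⟩
    have := (Finset.exists_min_image (W x) pos h).choose_spec
    simp only [dif_pos h]
    exact ⟨⟨_, this.1, rfl⟩, this.2⟩
  obtain ⟨lo, hlo⟩ := hlo
  induction S using Finset.induction_on_max_value lo with
  | empty => exact ⟨fun _ => 0, by simp⟩
  | insert a s has hmax ih =>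
    obtain ⟨f, hf⟩ := ih fun b =>
      (Finset.card_le_card (Finset.filter_subset_filter _ (Finset.subset_insert a s))).trans (hL b)
    -- The intervals are coloured by increasing left endpoint. Those already coloured that meet `W
    -- a` all contain its left endpoint, hence there are at most `L` of them and a colour is free.
    set T := s.filter fun x => ¬ Disjoint (W x) (W a) with hT
    have hTc : T.card ≤ L := by
      rcases (W a).eq_empty_or_nonempty with h | h
      · simp [hT, h]
      · obtain ⟨⟨b, hb, hbl⟩, hb'⟩ := hlo a h
        refine (Finset.card_le_card ?_).trans (hL b)
        intro x hx
        obtain ⟨hxs, hd⟩ := Finset.mem_filter.1 hx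
        obtain ⟨c, hc, hca⟩ := Finset.not_disjoint_iff.1 hd
        obtain ⟨⟨d, hd, hdl⟩, -⟩ := hlo x ⟨c, hc⟩
        refine Finset.mem_filter.2 ⟨Finset.mem_insert_of_mem hxs, hconv x d hd c hc b ?_ ?_⟩
        · rw [hdl, hbl]; exact hmax x hxs
        · rw [hbl]; exact hb' c hca
    obtain ⟨c, hc⟩ : ∃ c : Fin (L + 1), c ∉ T.image f := by
      by_contra! hall
      have : (Finset.univ : Finset (Fin (L + 1))).card ≤ (T.image f).card :=
        Finset.card_le_card fun c _ => hall c
      have h2 := Finset.card_image_le (s := T) (f := f)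
      simp at this
      omega
    have key : ∀ x ∈ s, f x = c → Disjoint (W x) (W a) := by
      intro x hx hfx
      by_contra hd
      exact hc (Finset.mem_image.2 ⟨x, Finset.mem_filter.2 ⟨hx, hd⟩, hfx⟩)
    refine ⟨Function.update f a c, ?_⟩
    intro x hx x' hx' hne heq
    rcases Finset.mem_insert.1 hx with rfl | hxs <;> rcases Finset.mem_insert.1 hx' with rfl | hxs'
    · exact absurd rfl hne
    · rw [Function.update_self, Function.update_of_ne hne.symm] at heq
      exact (key x' hxs' heq.symm).symm
    · rw [Function.update_self, Function.update_of_ne hne] at heq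
      exact key x hxs heq
    · have h1 : x ≠ a := fun h => has (h ▸ hxs)
      have h2 : x' ≠ a := fun h => has (h ▸ hxs')
      rw [Function.update_of_ne h1, Function.update_of_ne h2] at heq
      exact hf x hxs x' hxs' hne heq

/-- The middle element of `2 * k - 1` elements is counted on both sides, so each side has `k`; this
is the origin of the threshold in the theorem. Ties in `pos` only enlarge the sides. -/
theorem exists_median {pos : B → ℕ} {D : Finset B} {k : ℕ}
    (hk : 1 ≤ k) (hD : 2 * k - 1 ≤ D.card) :
    ∃ d ∈ D, k ≤ (D.filter fun y => pos y ≤ pos d).card ∧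
      k ≤ (D.filter fun y => pos d ≤ pos y).card := by
  set T := D.filter fun d => k ≤ (D.filter fun y => pos y ≤ pos d).card with hT
  have hTne : T.Nonempty := by
    have hne : D.Nonempty := Finset.card_pos.1 (by omega)
    obtain ⟨d, hd, hmax⟩ := Finset.exists_max_image D pos hne
    refine ⟨d, Finset.mem_filter.2 ⟨hd, ?_⟩⟩
    rw [Finset.filter_true_of_mem hmax]
    omega
  obtain ⟨d, hd, hmin⟩ := Finset.exists_min_image T pos hTne
  obtain ⟨hdD, hdk⟩ := Finset.mem_filter.1 hd
  refine ⟨d, hdD, hdk, ?_⟩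
  have hlt : (D.filter fun y => pos y < pos d).card < k := by
    by_contra! hc
    have hne : (D.filter fun y => pos y < pos d).Nonempty := Finset.card_pos.1 (by omega)
    obtain ⟨e, he, hmax⟩ := Finset.exists_max_image _ pos hne
    obtain ⟨heD, hed⟩ := Finset.mem_filter.1 he
    refine hed.not_ge (hmin e (Finset.mem_filter.2 ⟨heD, hc.trans (Finset.card_le_card ?_)⟩))
    intro y hy
    exact Finset.mem_filter.2 ⟨(Finset.mem_filter.1 hy).1, hmax y hy⟩
  have := Finset.card_filter_add_card_filter_not (s := D) (fun y => pos d ≤ pos y)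
  simp only [not_le] at this
  omega


/-- The difference of the two excesses is the difference of the degrees, so the bottom of smaller
degree has the smaller excess. -/
theorem deg_lt_of_filter_le {E : A → B → Prop} {X : Finset A} {Y : Finset B} {K : ℕ}
    (h : NearChain (flip E) K Y X) {y y' : B} (hy : y ∈ Y) (hy' : y' ∈ Y)
    (hle : deg (flip E) y X ≤ deg (flip E) y' X) : excess (flip E) y y' X < K := by
  rcases h y hy y' hy' with h | h
  · exact h
  · refine lt_of_le_of_lt ?_ h
    have h1 : ∀ z z' : B, excess (flip E) z z' X = ((X.filter fun x => flip E z x) \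
        (X.filter fun x => flip E z' x)).card := by
      intro z z'
      unfold excess
      congr 1
      ext x; simp; tauto
    rw [h1, h1]
    exact Finset.card_sdiff_le_card_sdiff_iff.2 hle

/-- If the bottoms form a near chain and there are not too many disjoint induced stars centred at
the top, nor in the complement, then the tops split into boundedly many near chains, with the
threshold `2 * k - 1`. -/
theorem exists_sharp_colouring {E : A → B → Prop} {K n m k : ℕ} (hk : 1 ≤ k)
    {X : Finset A} {Y : Finset B} (hY : NearChain (flip E) K Y X) (h₁ : ¬ Stars E k n X Y)
    (h₂ : ¬ Stars (co E) k m X Y) :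
    ∃ f : A → Fin ((n + m) * (2 * (k * K) + 1) + 2), ∀ c,
      NearChain E (2 * k - 1) (X.filter fun x => f x = c) Y := by
  set pos : B → ℕ := fun y => deg (flip E) y X with hpos
  set lft : B → Finset B := fun c => Y.filter fun y => pos y ≤ pos c with hlft
  set rgt : B → Finset B := fun c => Y.filter fun y => pos c ≤ pos y with hrgt
  have lft_mono : ∀ a b, pos a ≤ pos b → lft a ⊆ lft b := fun a b h y hy =>
    Finset.mem_filter.2 ⟨(Finset.mem_filter.1 hy).1, (Finset.mem_filter.1 hy).2.trans h⟩
  have rgt_mono : ∀ a b, pos a ≤ pos b → rgt b ⊆ rgt a := fun a b h y hy =>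
    Finset.mem_filter.2 ⟨(Finset.mem_filter.1 hy).1, h.trans (Finset.mem_filter.1 hy).2⟩
  -- In an exact chain the neighbours of `x` would be a final segment of the order by degree. `W x`
  -- is the zone where `x` violates this by `k` on both sides; it is convex for `pos`.
  set W : A → Finset B := fun x => Y.filter fun c => k ≤ deg E x (lft c) ∧ k ≤ deg (co E) x (rgt c)
    with hW
  have memW : ∀ x c, c ∈ Y → k ≤ deg E x (lft c) → k ≤ deg (co E) x (rgt c) → c ∈ W x :=
    fun x c hc h h' => Finset.mem_filter.2 ⟨hc, h, h'⟩
  -- Consider the tops disordered at `b`. Among those not adjacent to `b`, a bottom left of `b` has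
  -- at most `K` neighbours, since its degree does not exceed that of `b`; too many such tops give
  -- `n` disjoint stars. Those adjacent to `b` give `m` stars of the complement in the same way.
  have hL : ∀ b ∈ Y, (X.filter fun x => b ∈ W x).card ≤ (n + m) * (2 * (k * K) + 1) := by
    intro b hb
    by_contra! hc
    set S := X.filter fun x => b ∈ W x with hS
    have hSX : S ⊆ X := Finset.filter_subset _ _
    have hdeg : ∀ x ∈ S, k ≤ deg E x (lft b) ∧ k ≤ deg (co E) x (rgt b) := fun x hx =>
      (Finset.mem_filter.1 (Finset.mem_filter.1 hx).2).2
    have hsum := Finset.card_filter_add_card_filter_not (s := S) (fun x => E x b)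
    rw [Nat.add_mul] at hc
    have : n * (2 * (k * K) + 1) ≤ (S.filter fun x => ¬ E x b).card ∨
        m * (2 * (k * K) + 1) ≤ (S.filter fun x => E x b).card := by omega
    rcases this with h | h
    · refine h₁ ((stars_of_deg (fun x hx => (hdeg x (Finset.mem_filter.1 hx).1).1) ?_ h).mono
        ((Finset.filter_subset _ _).trans hSX) (Finset.filter_subset _ _))
      intro y hy
      obtain ⟨hyY, hyb⟩ := Finset.mem_filter.1 hy
      refine le_trans (Finset.card_le_card ?_)
        (deg_lt_of_filter_le hY hyY hb hyb).le
      intro x hx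
      obtain ⟨hx1, hx2⟩ := Finset.mem_filter.1 hx
      obtain ⟨hx3, hx4⟩ := Finset.mem_filter.1 hx1
      exact Finset.mem_filter.2 ⟨hSX hx3, hx2, hx4⟩
    · refine h₂ ((stars_of_deg (fun x hx => (hdeg x (Finset.mem_filter.1 hx).1).2) ?_ h).mono
        ((Finset.filter_subset _ _).trans hSX) (Finset.filter_subset _ _))
      intro y hy
      obtain ⟨hyY, hyb⟩ := Finset.mem_filter.1 hy
      refine le_trans (Finset.card_le_card ?_)
        (deg_lt_of_filter_le hY hb hyY hyb).le
      intro x hx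
      obtain ⟨hx1, hx2⟩ := Finset.mem_filter.1 hx
      obtain ⟨hx3, hx4⟩ := Finset.mem_filter.1 hx1
      exact Finset.mem_filter.2 ⟨hSX hx3, hx4, hx2⟩
  have hconv : ∀ x, ∀ a ∈ W x, ∀ b ∈ W x, ∀ c ∈ Y, pos a ≤ pos c → pos c ≤ pos b → c ∈ W x := by
    intro x a ha b hb c hc hac hcb
    exact memW x c hc ((Finset.mem_filter.1 ha).2.1.trans (deg_mono _ _ (lft_mono _ _ hac)))
      ((Finset.mem_filter.1 hb).2.2.trans (deg_mono _ _ (rgt_mono _ _ hcb)))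
  obtain ⟨g, hg⟩ : ∃ g : A → Fin ((n + m) * (2 * (k * K) + 1) + 1), ∀ x ∈ X, ∀ x' ∈ X, x ≠ x' →
      g x = g x' → Disjoint (W x) (W x') := by
    obtain ⟨g, hg⟩ := exists_interval_colouring (B := Y) (fun y => pos y)
      (fun x => (Finset.univ : Finset Y).filter fun y => (y : B) ∈ W x) X
      (L := (n + m) * (2 * (k * K) + 1)) (by
        intro x a ha b hb c hac hcb
        exact Finset.mem_filter.2 ⟨Finset.mem_univ _, hconv x a (Finset.mem_filter.1 ha).2 b
          (Finset.mem_filter.1 hb).2 c c.2 hac hcb⟩) (by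
        intro b
        refine le_trans (Finset.card_le_card ?_) (hL b b.2)
        intro x hx
        simpa using hx)
    refine ⟨g, fun x hx x' hx' hne h => Finset.disjoint_left.2 fun y hy hy' => ?_⟩
    have hyY : y ∈ Y := (Finset.mem_filter.1 hy).1
    exact Finset.disjoint_left.1 (hg x hx x' hx' hne h)
      (show (⟨y, hyY⟩ : Y) ∈ _ by simpa using hy) (by simpa using hy')
  -- The points `d` and `d'` lie in `W x`. A point of `W x'` outside the stretch between them would
  -- put `d` or `d'` into `W x'`, and a point inside the stretch lies in `W x` by convexity: both
  -- contradict disjointness.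
  have key : ∀ x ∈ X, ∀ x' ∈ X, Disjoint (W x) (W x') → ((W x).Nonempty → (W x').Nonempty) →
      ∀ d ∈ Y, ∀ d' ∈ Y, k ≤ deg E x (lft d) → k ≤ deg (co E) x (rgt d') →
      k ≤ deg (co E) x' (rgt d) → k ≤ deg E x' (lft d') → pos d ≤ pos d' → False := by
    intro x hx x' hx' hdis hne d hd d' hd' h1 h2 h3 h4 hle
    have hdW : d ∈ W x := memW x d hd h1 (h2.trans (deg_mono _ _ (rgt_mono _ _ hle)))
    have hdW' : d' ∈ W x := memW x d' hd' (h1.trans (deg_mono _ _ (lft_mono _ _ hle))) h2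
    obtain ⟨e, he⟩ := hne ⟨d, hdW⟩
    obtain ⟨heY, he1, he2⟩ := Finset.mem_filter.1 he
    have hde : pos d ≤ pos e := by
      by_contra! hc
      exact Finset.disjoint_left.1 hdis hdW
        (memW x' d hd (he1.trans (deg_mono _ _ (lft_mono _ _ hc.le))) h3)
    have hed : pos e ≤ pos d' := by
      by_contra! hc
      exact Finset.disjoint_left.1 hdis hdW'
        (memW x' d' hd' h4 (he2.trans (deg_mono _ _ (rgt_mono _ _ hc.le))))
    exact Finset.disjoint_left.1 hdis (hconv x d hdW d' hdW' e heY hde hed) he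
  -- Colour `0` is kept for tops with empty `W x`, so that within a class the zones are all empty or
  -- all nonempty.
  refine ⟨fun x => if (W x).Nonempty then (g x).succ else 0, fun c x hx x' hx' => ?_⟩
  obtain ⟨hxX, hxc⟩ := Finset.mem_filter.1 hx
  obtain ⟨hxX', hxc'⟩ := Finset.mem_filter.1 hx'
  rw [← hxc] at hxc'
  by_contra! hbad
  have hne : x ≠ x' := by
    rintro rfl
    have := hbad.1
    simp [excess] at this
    omega
  have hW2 : ((W x).Nonempty ↔ (W x').Nonempty) ∧ Disjoint (W x) (W x') := by
    by_cases h1 : (W x).Nonempty <;> by_cases h2 : (W x').Nonempty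
    · simp only [h1, h2, if_true] at hxc'
      exact ⟨by simp [h1, h2], hg x hxX x' hxX' hne (Fin.succ_injective _ hxc').symm⟩
    · simp only [h1, h2, if_true, if_false] at hxc'
      exact absurd hxc'.symm (Fin.succ_ne_zero _)
    · simp only [h1, h2, if_true, if_false] at hxc'
      exact absurd hxc' (Fin.succ_ne_zero _)
    · rw [Finset.not_nonempty_iff_eq_empty] at h1
      exact ⟨by simp [h1, Finset.not_nonempty_iff_eq_empty.1 h2], by simp [h1]⟩
  -- The median of the bottoms adjacent to `x` but not to `x'` serves twice: `x` has `k` neighbours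
  -- weakly to its left and `x'` has `k` non-neighbours weakly to its right.
  obtain ⟨d, hd, hd1, hd2⟩ := exists_median (pos := pos) hk hbad.1
  obtain ⟨d', hd', hd1', hd2'⟩ := exists_median (pos := pos) hk hbad.2
  have hdY := (Finset.mem_filter.1 hd).1
  have hdY' := (Finset.mem_filter.1 hd').1
  have e1 : k ≤ deg E x (lft d) := hd1.trans (Finset.card_le_card fun y hy => by
    simp only [hlft, Finset.mem_filter] at hy ⊢; tauto)
  have e2 : k ≤ deg (co E) x' (rgt d) := hd2.trans (Finset.card_le_card fun y hy => by
    simp only [hrgt, co, Finset.mem_filter] at hy ⊢; tauto)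
  have e3 : k ≤ deg E x' (lft d') := hd1'.trans (Finset.card_le_card fun y hy => by
    simp only [hlft, Finset.mem_filter] at hy ⊢; tauto)
  have e4 : k ≤ deg (co E) x (rgt d') := hd2'.trans (Finset.card_le_card fun y hy => by
    simp only [hrgt, co, Finset.mem_filter] at hy ⊢; tauto)
  rcases le_total (pos d) (pos d') with h | h
  · exact key x hxX x' hxX' hW2.2 hW2.1.1 d hdY d' hdY' e1 e4 e2 e3 h
  · exact key x' hxX' x hxX hW2.2.symm hW2.1.2 d' hdY' d hdY e3 e2 e4 e1 h

/-! ### Scales of largeness and the rigidity of large pairs -/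

/-- A scale of largeness predicates `L 0, L 1, …` on pairs of vertex sets. A pair which is large at
level `i + 1` and is cut into at most `c` pieces on either side has a piece pair which is large at
level `i`; large pairs contain almost as many induced stars of each of the four types as the four
forbidden configurations have. -/
structure Scale (E : A → B → Prop) (k k' c n₁ n₂ m₁ m₂ : ℕ)
    (L : ℕ → Finset A → Finset B → Prop) : Prop where
  one_le : 1 ≤ k
  le_fat : k ≤ k'
  sq_le : k * k ≤ c
  add_two_le : k + 2 ≤ c
  two_le_n₁ : 2 ≤ n₁
  two_le_n₂ : 2 ≤ n₂
  two_le_m₁ : 2 ≤ m₁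
  two_le_m₂ : 2 ≤ m₂
  down : ∀ i X Y, L (i + 1) X Y → L i X Y
  mono : ∀ i X Y X' Y', L i X Y → X ⊆ X' → Y ⊆ Y' → L i X' Y'
  split : ∀ i X Y (p : A → ℕ) (q : B → ℕ), (∀ x, p x < c) → (∀ y, q y < c) → L (i + 1) X Y →
    ∃ s t, L i (X.filter fun x => p x = s) (Y.filter fun y => q y = t)
  card_left : ∀ X Y, L 0 X Y → c < X.card
  card_right : ∀ X Y, L 0 X Y → c < Y.card
  rich_n₁ : ∀ X Y, L 0 X Y → Stars (flip E) k' n₁ Y X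
  rich_n₂ : ∀ X Y, L 0 X Y → Stars E k' n₂ X Y
  rich_m₁ : ∀ X Y, L 0 X Y → Stars (co (flip E)) k' m₁ Y X
  rich_m₂ : ∀ X Y, L 0 X Y → Stars (co E) k' m₂ X Y
  free_n₁ : ∀ X Y, ¬ Stars (flip E) k (n₁ + 1) Y X
  free_n₂ : ∀ X Y, ¬ Stars E k (n₂ + 1) X Y
  free_m₁ : ∀ X Y, ¬ Stars (co (flip E)) k (m₁ + 1) Y X
  free_m₂ : ∀ X Y, ¬ Stars (co E) k (m₂ + 1) X Y

namespace Scale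

variable {E : A → B → Prop} {k k' c n₁ n₂ m₁ m₂ : ℕ} {L : ℕ → Finset A → Finset B → Prop}

/-- Together with `compl`, this makes each statement about tops and adjacency available in four
versions. -/
theorem flip (h : Scale E k k' c n₁ n₂ m₁ m₂ L) :
    Scale (flip E) k k' c n₂ n₁ m₂ m₁ (fun i Y X => L i X Y) where
  one_le := h.one_le
  le_fat := h.le_fat
  sq_le := h.sq_le
  add_two_le := h.add_two_le
  two_le_n₁ := h.two_le_n₂
  two_le_n₂ := h.two_le_n₁
  two_le_m₁ := h.two_le_m₂
  two_le_m₂ := h.two_le_m₁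
  down i X Y := h.down i Y X
  mono i X Y X' Y' hL hX hY := h.mono i _ _ _ _ hL hY hX
  split i X Y p q hp hq hL := by
    obtain ⟨s, t, hst⟩ := h.split i Y X q p hq hp hL
    exact ⟨t, s, hst⟩
  card_left X Y := h.card_right Y X
  card_right X Y := h.card_left Y X
  rich_n₁ X Y := h.rich_n₂ Y X
  rich_n₂ X Y := h.rich_n₁ Y X
  rich_m₁ X Y := h.rich_m₂ Y X
  rich_m₂ X Y := h.rich_m₁ Y X
  free_n₁ X Y := h.free_n₂ Y X
  free_n₂ X Y := h.free_n₁ Y X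
  free_m₁ X Y := h.free_m₂ Y X
  free_m₂ X Y := h.free_m₁ Y X

theorem compl (h : Scale E k k' c n₁ n₂ m₁ m₂ L) : Scale (co E) k k' c m₁ m₂ n₁ n₂ L where
  one_le := h.one_le
  le_fat := h.le_fat
  sq_le := h.sq_le
  add_two_le := h.add_two_le
  two_le_n₁ := h.two_le_m₁
  two_le_n₂ := h.two_le_m₂
  two_le_m₁ := h.two_le_n₁
  two_le_m₂ := h.two_le_n₂
  down := h.down
  mono := h.mono
  split := h.split
  card_left := h.card_left
  card_right := h.card_right
  rich_n₁ := h.rich_m₁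
  rich_n₂ := h.rich_m₂
  rich_m₁ X Y hL := (co_co (Function.swap E)).symm ▸ h.rich_n₁ X Y hL
  rich_m₂ X Y hL := (co_co E).symm ▸ h.rich_n₂ X Y hL
  free_n₁ := h.free_m₁
  free_n₂ := h.free_m₂
  free_m₁ X Y hL := h.free_n₁ X Y (by rwa [show _root_.flip (co E) = co (Function.swap E) from rfl, co_co] at hL)
  free_m₂ X Y hL := h.free_n₂ X Y (by rwa [co_co] at hL)

theorem down_le (h : Scale E k k' c n₁ n₂ m₁ m₂ L) {i j : ℕ} (hij : i ≤ j) {X : Finset A}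
    {Y : Finset B} (hL : L j X Y) : L i X Y := by
  induction hij with
  | refl => exact hL
  | step _ ih => exact ih (h.down _ _ _ hL)

/-- The values are enumerated to obtain numerical labels. A large piece is nonempty, so any member
of it names the common value; the default label `0` is never used on `X` or `Y`. -/
theorem split_of_mem (h : Scale E k k' c n₁ n₂ m₁ m₂ L) {S : Type*} {T : Type*} {i : ℕ}
    {X : Finset A} {Y : Finset B} (p : A → S) (q : B → T) (SS : Finset S) (TT : Finset T)
    (hp : ∀ x ∈ X, p x ∈ SS) (hq : ∀ y ∈ Y, q y ∈ TT) (hS : SS.card ≤ c) (hT : TT.card ≤ c)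
    (hL : L (i + 1) X Y) :
    ∃ s t, ∃ X' ⊆ X, ∃ Y' ⊆ Y, L i X' Y' ∧ (∀ x ∈ X', p x = s) ∧ ∀ y ∈ Y', q y = t := by
  have hc : 0 < c := by have := h.add_two_le; omega
  obtain ⟨s, t, hst⟩ := h.split i X Y
    (fun x => if hx : p x ∈ SS then (SS.equivFin ⟨p x, hx⟩ : ℕ) else 0)
    (fun y => if hy : q y ∈ TT then (TT.equivFin ⟨q y, hy⟩ : ℕ) else 0)
    (by
      intro x
      split_ifs with hx
      · exact (SS.equivFin ⟨p x, hx⟩).2.trans_le hS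
      · exact hc)
    (by
      intro y
      split_ifs with hy
      · exact (TT.equivFin ⟨q y, hy⟩).2.trans_le hT
      · exact hc) hL
  have h0 := h.down_le (Nat.zero_le i) hst
  obtain ⟨x₀, hx₀⟩ := Finset.card_pos.1 ((Nat.zero_le _).trans_lt (h.card_left _ _ h0))
  obtain ⟨y₀, hy₀⟩ := Finset.card_pos.1 ((Nat.zero_le _).trans_lt (h.card_right _ _ h0))
  refine ⟨p x₀, q y₀, _, Finset.filter_subset _ _, _, Finset.filter_subset _ _, hst, ?_, ?_⟩
  · intro x hx
    rw [Finset.mem_filter] at hx hx₀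
    have h1 := hx.2.trans hx₀.2.symm
    rw [dif_pos (hp x hx.1), dif_pos (hp x₀ hx₀.1)] at h1
    simpa using SS.equivFin.injective (Fin.ext h1)
  · intro y hy
    rw [Finset.mem_filter] at hy hy₀
    have h1 := hy.2.trans hy₀.2.symm
    rw [dif_pos (hq y hy.1), dif_pos (hq y₀ hy₀.1)] at h1
    simpa using TT.equivFin.injective (Fin.ext h1)

theorem split_left (h : Scale E k k' c n₁ n₂ m₁ m₂ L) {i : ℕ} {X : Finset A} {Y : Finset B}
    (p : A → Prop) (hL : L (i + 1) X Y) :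
    L i (X.filter fun x => p x) Y ∨ L i (X.filter fun x => ¬ p x) Y := by
  have hc := h.add_two_le
  obtain ⟨s, t, X', hX', Y', hY', hL', hs, -⟩ := h.split_of_mem (fun x => decide (p x))
    (fun _ => ()) Finset.univ Finset.univ (fun _ _ => Finset.mem_univ _)
    (fun _ _ => Finset.mem_univ _) (by simp; omega) (by simp; omega) hL
  cases s
  · right
    exact h.mono _ _ _ _ _ hL' (fun x hx => Finset.mem_filter.2 ⟨hX' hx, by simpa using hs x hx⟩)
      hY'
  · left
    exact h.mono _ _ _ _ _ hL' (fun x hx => Finset.mem_filter.2 ⟨hX' hx, by simpa using hs x hx⟩)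
      hY'

theorem split_right (h : Scale E k k' c n₁ n₂ m₁ m₂ L) {i : ℕ} {X : Finset A} {Y : Finset B}
    (p : B → Prop) (hL : L (i + 1) X Y) :
    L i X (Y.filter fun y => p y) ∨ L i X (Y.filter fun y => ¬ p y) :=
  h.flip.split_left p hL

/-- A part with at most `c` vertices is not large, so the complementary part is. -/
theorem sdiff_left (h : Scale E k k' c n₁ n₂ m₁ m₂ L) {i : ℕ} {X S : Finset A} {Y : Finset B}
    (hS : S.card ≤ c) (hL : L (i + 1) X Y) : L i (X \ S) Y := by
  obtain ⟨p, hp⟩ : ∃ p : A → Prop, ∀ x, p x ↔ x ∈ S := ⟨_, fun _ => Iff.rfl⟩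
  rcases h.split_left p hL with h1 | h1
  · have h2 := h.card_left _ _ (h.down_le (Nat.zero_le i) h1)
    refine absurd (h2.trans_le (le_trans (Finset.card_le_card ?_) hS)) (lt_irrefl _)
    intro x hx
    exact (hp x).1 (Finset.mem_filter.1 hx).2
  · exact h.mono _ _ _ _ _ h1 (fun x hx => by simpa [hp] using hx) subset_rfl

/-- If `x` is unrelated to a large part of `(X, Y)`, then it has few neighbours among the vertices
which have few neighbours in `X`. -/
theorem deg_lt (h : Scale E k k' c n₁ n₂ m₁ m₂ L) {x : A} {X : Finset A} {Y T : Finset B}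
    (hx : L 1 X (Y.filter fun y => ¬ E x y)) (hT : ∀ y ∈ T, deg (Function.swap E) y X < k) :
    deg E x T < k := by
  by_contra! hc
  obtain ⟨S, hS, hSc⟩ := Finset.exists_subset_card_eq hc
  have hST : ∀ y ∈ S, y ∈ T ∧ E x y := fun y hy => Finset.mem_filter.1 (hS hy)
  have h1 : (X.filter fun x' => ∃ y ∈ S, E x' y).card ≤ c :=
    (card_filter_exists_le hSc.le fun y hy => (hT y (hST y hy).1).le).trans h.sq_le
  -- After the at most `k * k` neighbours of `S` are deleted, a large pair avoiding both `x` and `S`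
  -- remains. Its `n₂` stars and the star at `x` with leaves `S` are one star too many.
  have h2 := (h.rich_n₂ _ _ (h.sdiff_left h1 hx)).mono_leaves h.le_fat
  refine h.free_n₂ (insert x X) (S ∪ Y) ⟨x, Finset.mem_insert_self _ _, S,
    Finset.subset_union_left, hSc, fun y hy => (hST y hy).2, h2.mono ?_ ?_⟩
  · intro z hz
    simp only [Finset.mem_sdiff, Finset.mem_filter, not_and, not_exists] at hz
    exact Finset.mem_filter.2 ⟨Finset.mem_insert_of_mem hz.1, fun y hy => hz.2 hz.1 y hy⟩
  · intro y hy
    rw [Finset.mem_filter] at hy ⊢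
    exact ⟨Finset.mem_union_right _ hy.1, hy.2⟩

theorem deg_swap_lt (h : Scale E k k' c n₁ n₂ m₁ m₂ L) {y : B} {X T : Finset A} {Y : Finset B}
    (hy : L 1 (X.filter fun x => ¬ E x y) Y) (hT : ∀ x ∈ T, deg E x Y < k) :
    deg (Function.swap E) y T < k :=
  h.flip.deg_lt hy hT

theorem deg_co_lt (h : Scale E k k' c n₁ n₂ m₁ m₂ L) {x : A} {X : Finset A} {Y T : Finset B}
    (hx : L 1 X (Y.filter fun y => E x y)) (hT : ∀ y ∈ T, deg (co (Function.swap E)) y X < k) :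
    deg (co E) x T < k :=
  h.compl.deg_lt (by simpa [co] using hx) hT

theorem deg_co_swap_lt (h : Scale E k k' c n₁ n₂ m₁ m₂ L) {y : B} {X T : Finset A} {Y : Finset B}
    (hy : L 1 (X.filter fun x => E x y) Y) (hT : ∀ x ∈ T, deg (co E) x Y < k) :
    deg (co (Function.swap E)) y T < k :=
  h.flip.deg_co_lt hy hT

/-- Label each top by an element of `S` that it misses, or by `none`. A large class labelled by `y`
would lie in the non-neighbourhood of `y`, so the class `none` is the large one. -/
theorem exists_large_common (h : Scale E k k' c n₁ n₂ m₁ m₂ L) {i : ℕ} {X : Finset A}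
    {Y S : Finset B} (hL : L (i + 1) X Y) (hSc : S.card ≤ k)
    (hS : ∀ y ∈ S, ¬ L i (X.filter fun x => ¬ E x y) Y) :
    ∃ X' ⊆ X, L i X' Y ∧ ∀ x ∈ X', ∀ y ∈ S, E x y := by
  have hcc := h.add_two_le
  set p : A → Option B := fun x' => if hx' : ∃ y ∈ S, ¬ E x' y then some hx'.choose else none
  obtain ⟨s, t, X', hX', Y', hY', hL', hs, -⟩ := h.split_of_mem p (fun _ => ())
    (insert none (S.image some)) Finset.univ
    (by
      intro z _
      by_cases hz : ∃ y ∈ S, ¬ E z y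
      · simp only [p, dif_pos hz]
        exact Finset.mem_insert_of_mem (Finset.mem_image_of_mem _ hz.choose_spec.1)
      · simp [p, dif_neg hz])
    (fun _ _ => Finset.mem_univ _)
    ((Finset.card_insert_le _ _).trans (by
      have := Finset.card_image_le (s := S) (f := some)
      omega))
    (by simp; omega) hL
  obtain ⟨z₀, hz₀⟩ := Finset.card_pos.1
    ((Nat.zero_le _).trans_lt (h.card_left _ _ (h.down_le (Nat.zero_le _) hL')))
  cases s with
  | some y =>
    have hy : ∀ z, p z = some y → y ∈ S ∧ ¬ E z y := by
      intro z hz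
      by_cases hz' : ∃ y ∈ S, ¬ E z y
      · simp only [p, dif_pos hz', Option.some.injEq] at hz
        exact hz ▸ hz'.choose_spec
      · simp [p, dif_neg hz'] at hz
    exact (hS y (hy z₀ (hs z₀ hz₀)).1 (h.mono _ _ _ _ _ hL'
      (fun z hz => Finset.mem_filter.2 ⟨hX' hz, (hy z (hs z hz)).2⟩) hY')).elim
  | none =>
    refine ⟨X', hX', h.mono _ _ _ _ _ hL' subset_rfl hY', fun z hz y hy => ?_⟩
    by_contra hn
    have hz' : ∃ y ∈ S, ¬ E z y := ⟨y, hy, hn⟩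
    have := hs z hz
    simp [p, dif_pos hz'] at this

/-- If `x` and the elements of `T` are unrelated to no large part of a large pair `(X, Y)`, then `x`
is related to almost all of `T`. -/
theorem deg_co_lt_of_not_large (h : Scale E k k' c n₁ n₂ m₁ m₂ L) {x : A} {X : Finset A}
    {Y T : Finset B} (hL : L 3 X Y) (hx : ¬ L 1 X (Y.filter fun y => ¬ E x y))
    (hT : ∀ y ∈ T, ¬ L 1 (X.filter fun x => ¬ E x y) Y) : deg (co E) x T < k := by
  by_contra! hc
  obtain ⟨S, hS, hSc⟩ := Finset.exists_subset_card_eq hc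
  have hST : ∀ y ∈ S, y ∈ T ∧ ¬ E x y := fun y hy => Finset.mem_filter.1 (hS hy)
  obtain ⟨X', hX', h1, hXS⟩ := h.exists_large_common hL hSc.le
    fun y hy hL' => hT y (hST y hy).1 (h.down _ _ _ hL')
  -- If the neighbours of `x` are the large side, the `m₂` complement stars there and the one at `x`
  -- with leaves `S` are one too many.
  rcases h.split_right (fun y => E x y) h1 with h2 | h2
  · have h3 := (h.rich_m₂ _ _ (h.down _ _ _ h2)).mono_leaves h.le_fat
    refine h.free_m₂ (insert x X) (S ∪ Y) ⟨x, Finset.mem_insert_self _ _, S,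
      Finset.subset_union_left, hSc, fun y hy => (hST y hy).2, h3.mono ?_ ?_⟩
    · exact fun z hz => Finset.mem_filter.2
        ⟨Finset.mem_insert_of_mem (hX' hz), fun y hy hn => hn (hXS z hz y hy)⟩
    · intro y hy
      rw [Finset.mem_filter] at hy ⊢
      exact ⟨Finset.mem_union_right _ hy.1, fun hn => hn hy.2⟩
  · exact hx (h.mono _ _ _ _ _ h2 hX' subset_rfl)

theorem deg_co_swap_lt_of_not_large (h : Scale E k k' c n₁ n₂ m₁ m₂ L) {y : B} {X T : Finset A}
    {Y : Finset B} (hL : L 3 X Y) (hy : ¬ L 1 (X.filter fun x => ¬ E x y) Y)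
    (hT : ∀ x ∈ T, ¬ L 1 X (Y.filter fun y => ¬ E x y)) : deg (co (Function.swap E)) y T < k :=
  h.flip.deg_co_lt_of_not_large hL hy hT

end Scale

/-! ### Frames and the separation of large pairs -/

theorem exists_minimal_nat {α : Type*} (p : α → Prop) (μ : α → ℕ) (h : ∃ a, p a) :
    ∃ a, p a ∧ ∀ b, p b → μ a ≤ μ b := by
  have h' : ∃ n, ∃ a, p a ∧ μ a = n := let ⟨a, ha⟩ := h; ⟨_, a, ha, rfl⟩
  obtain ⟨a, ha, hn⟩ := Nat.find_spec h'
  exact ⟨a, ha, fun b hb => hn ▸ Nat.find_min' h' ⟨b, hb, rfl⟩⟩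

/-- The tops with fewer than `k` neighbours in each of the sets `P i`. -/
def Low (E : A → B → Prop) (k : ℕ) {n : ℕ} (P : Fin n → Finset B) (x : A) : Prop :=
  ∀ i, deg E x (P i) < k

/-- The bottoms adjacent to all the tops `a i`. -/
def Above (E : A → B → Prop) {n : ℕ} (a : Fin n → A) (y : B) : Prop := ∀ i, E (a i) y

theorem deg_add_deg_co (E : A → B → Prop) (x : A) (Y : Finset B) :
    deg E x Y + deg (co E) x Y = Y.card := by
  rw [← Finset.card_filter_add_card_filter_not (s := Y) (fun y => E x y)]
  unfold deg co
  congr!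

/-- The union of the neighbourhoods of the centres `a i`. -/
noncomputable def shade [Fintype B] (E : A → B → Prop) {n : ℕ} (a : Fin n → A) : Finset B :=
  Finset.univ.filter fun y => ∃ i, E (a i) y

theorem card_shade_lt [Fintype B] {E : A → B → Prop} {k n : ℕ} {a b : Fin n → A} {P : Finset B}
    (h : ∀ i, deg E (a i) (Finset.univ.filter fun y => y ∉ shade E b) ≤ k)
    (hP : ∀ y ∈ P, y ∈ shade E b ∧ y ∉ shade E a) (hc : n * k < P.card) :
    (shade E a).card < (shade E b).card := by
  have h1 : (shade E a \ shade E b).card ≤ n * k := by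
    have : shade E a \ shade E b ⊆ Finset.univ.biUnion fun i : Fin n =>
        (Finset.univ.filter fun y => y ∉ shade E b).filter fun y => E (a i) y := by
      intro y hy
      obtain ⟨hya, hyb⟩ := Finset.mem_sdiff.1 hy
      obtain ⟨i, hi⟩ := (Finset.mem_filter.1 hya).2
      exact Finset.mem_biUnion.2 ⟨i, Finset.mem_univ _, Finset.mem_filter.2
        ⟨Finset.mem_filter.2 ⟨Finset.mem_univ _, hyb⟩, hi⟩⟩
    refine (Finset.card_le_card this).trans ?_
    simpa using Finset.card_biUnion_le_card_mul (Finset.univ : Finset (Fin n)) _ k fun i _ => h i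
  have h2 : P ⊆ shade E b \ shade E a := fun y hy => Finset.mem_sdiff.2 (hP y hy)
  exact Finset.card_sdiff_lt_card_sdiff_iff.1
    ((h1.trans_lt hc).trans_le (Finset.card_le_card h2))

theorem IsFrame.le_deg_co {E : A → B → Prop} {k k' n : ℕ} (hk : 2 * k ≤ k') {X : Finset A}
    {Y : Finset B} {a : Fin n → A} {P : Fin n → Finset B} (hF : IsFrame E k' n X Y a P) {x : A}
    (hx : Low E k P x) (i : Fin n) : k ≤ deg (co E) x (P i) := by
  have h1 := deg_add_deg_co E x (P i)
  have h2 := hx i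
  rw [hF.card] at h1
  omega

namespace Scale

variable {E : A → B → Prop} {k k' c n₁ n₂ m₁ m₂ : ℕ} {L : ℕ → Finset A → Finset B → Prop}

/-- If `x` had `k` neighbours outside the neighbourhoods of all centres, these would form a star at
`x`; shrinking each leaf set to `k` non-neighbours of `x` would then give `n₂ + 1` disjoint stars.
-/
theorem deg_lt_of_isFrame (h : Scale E k k' c n₁ n₂ m₁ m₂ L) {X : Finset A} {Y : Finset B}
    {a : Fin n₂ → A} {P : Fin n₂ → Finset B} (hF : IsFrame E k' n₂ X Y a P) {x : A}
    (hx : ∀ i, k ≤ deg (co E) x (P i)) {T : Finset B} (hT : ∀ y ∈ T, ∀ i, ¬ E (a i) y) :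
    deg E x T < k := by
  by_contra! hc
  obtain ⟨S, hS, hSc⟩ := Finset.exists_subset_card_eq hc
  have hST : ∀ y ∈ S, y ∈ T ∧ E x y := fun y hy => Finset.mem_filter.1 (hS hy)
  choose Q hQ hQc using fun i => Finset.exists_subset_card_eq (hx i)
  have hQP : ∀ i, ∀ y ∈ Q i, y ∈ P i ∧ ¬ E x y := fun i y hy => Finset.mem_filter.1 (hQ i hy)
  refine h.free_n₂ (insert x X) (S ∪ Y) ⟨x, Finset.mem_insert_self _ _, S,
    Finset.subset_union_left, hSc, fun y hy => (hST y hy).2,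
    IsFrame.stars (a := a) (P := Q) ⟨?_, ?_, hQc, ?_, ?_⟩⟩
  · exact fun i => Finset.mem_filter.2 ⟨Finset.mem_insert_of_mem (hF.mem i),
      fun y hy => hT y (hST y hy).1 i⟩
  · exact fun i y hy => Finset.mem_filter.2
      ⟨Finset.mem_union_right _ (hF.sub i (hQP i y hy).1), (hQP i y hy).2⟩
  · exact fun i y hy => hF.adj i y (hQP i y hy).1
  · exact fun i j hij y hy => hF.not_adj i j hij y (hQP i y hy).1

/-- A large pair whose traces on a frame are constant lies entirely after or entirely before the
frame. -/
theorem low_or_high (h : Scale E k k' c n₁ n₂ m₁ m₂ L) (hk : 2 * k ≤ k') {X₀ X : Finset A}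
    {Y₀ Y : Finset B} {a : Fin n₂ → A} {P : Fin n₂ → Finset B} (hF : IsFrame E k' n₂ X₀ Y₀ a P)
    {s : Finset B} {t : Finset (Fin n₂)} (hs : ∀ x ∈ X, ∀ i, ∀ y ∈ P i, E x y ↔ y ∈ s)
    (ht : ∀ y ∈ Y, ∀ i, E (a i) y ↔ i ∈ t) (hL : L 0 X Y) :
    ((∀ x ∈ X, Low E k P x) ∧ ∀ y ∈ Y, Above E a y) ∨
      ((∀ x ∈ X, Low (co E) k P x) ∧ ∀ y ∈ Y, Above (co E) a y) := by
  set N : Fin n₂ → ℕ := fun i => ((P i).filter fun y => y ∉ s).card with hN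
  set M : Fin n₂ → ℕ := fun i => ((P i).filter fun y => y ∈ s).card with hM
  have hMN : ∀ i, M i + N i = k' := fun i =>
    (Finset.card_filter_add_card_filter_not _).trans (hF.card i)
  have hdeg : ∀ x ∈ X, ∀ i, deg E x (P i) = M i := fun x hx i =>
    congrArg Finset.card (Finset.filter_congr fun y hy => hs x hx i y hy)
  have hdeg' : ∀ x ∈ X, ∀ i, deg (co E) x (P i) = N i := fun x hx i =>
    congrArg Finset.card (Finset.filter_congr fun y hy => not_congr (hs x hx i y hy))
  -- Otherwise the star at `a i`, with `k` leaves missed by all of `X`, extends the `n₂` stars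
  -- inside `(X, Y)`.
  have f1 : ∀ i, k ≤ N i → i ∈ t := by
    intro i hi
    by_contra hit
    obtain ⟨S, hS, hSc⟩ := Finset.exists_subset_card_eq hi
    have hSP : ∀ y ∈ S, y ∈ P i ∧ y ∉ s := fun y hy => Finset.mem_filter.1 (hS hy)
    refine h.free_n₂ (insert (a i) X) (S ∪ Y) ⟨a i, Finset.mem_insert_self _ _, S,
      Finset.subset_union_left, hSc, fun y hy => hF.adj i y (hSP y hy).1,
      ((h.rich_n₂ _ _ hL).mono_leaves h.le_fat).mono ?_ ?_⟩
    · exact fun x hx => Finset.mem_filter.2 ⟨Finset.mem_insert_of_mem hx, fun y hy hxy =>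
        (hSP y hy).2 ((hs x hx i y (hSP y hy).1).1 hxy)⟩
    · exact fun y hy => Finset.mem_filter.2 ⟨Finset.mem_union_right _ hy, fun hiy =>
        hit ((ht y hy i).1 hiy)⟩
  -- The same in the complement: `a j` misses the leaves of `P i`, while `X` is adjacent to them. As
  -- `k' ≥ 2 * k`, one of `M i` and `N i` is at least `k`, and as there are at least two stars, `f1`
  -- and `f2` force the same alternative for all indices.
  have f2 : ∀ i j, i ≠ j → k ≤ M i → j ∉ t := by
    intro i j hij hi hjt
    obtain ⟨S, hS, hSc⟩ := Finset.exists_subset_card_eq hi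
    have hSP : ∀ y ∈ S, y ∈ P i ∧ y ∈ s := fun y hy => Finset.mem_filter.1 (hS hy)
    refine h.free_m₂ (insert (a j) X) (S ∪ Y) ⟨a j, Finset.mem_insert_self _ _, S,
      Finset.subset_union_left, hSc, fun y hy => hF.not_adj i j hij y (hSP y hy).1,
      ((h.rich_m₂ _ _ hL).mono_leaves h.le_fat).mono ?_ ?_⟩
    · exact fun x hx => Finset.mem_filter.2 ⟨Finset.mem_insert_of_mem hx, fun y hy hxy =>
        hxy ((hs x hx i y (hSP y hy).1).2 (hSP y hy).2)⟩
    · exact fun y hy => Finset.mem_filter.2 ⟨Finset.mem_union_right _ hy, fun hiy =>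
        hiy ((ht y hy j).2 hjt)⟩
  have hn : ∀ i : Fin n₂, ∃ j, j ≠ i := fun i => by
    have : Nontrivial (Fin n₂) := Fin.nontrivial_iff_two_le.2 h.two_le_n₂
    exact exists_ne i
  by_cases hex : ∃ i, k ≤ N i
  · obtain ⟨i, hi⟩ := hex
    have hit := f1 i hi
    have hall : ∀ j, k ≤ N j := by
      intro j
      by_cases hji : j = i
      · exact hji ▸ hi
      · by_contra hj
        exact f2 j i hji (by have := hMN j; omega) hit
    refine Or.inl ⟨fun x hx i => ?_, fun y hy i => (ht y hy i).2 (f1 i (hall i))⟩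
    obtain ⟨j, hj⟩ := hn i
    rw [hdeg x hx i]
    by_contra! hc
    exact f2 i j hj.symm hc (f1 j (hall j))
  · push Not at hex
    refine Or.inr ⟨fun x hx i => hdeg' x hx i ▸ hex i, fun y hy i hiy => ?_⟩
    obtain ⟨j, hj⟩ := hn i
    exact f2 j i hj (by have := hMN j; have := hex j; omega) ((ht y hy i).1 hiy)

/-- There are at most `2 ^ (n₂ * k')` traces on the leaves and on the centres, so one level of the
scale pays for making them constant. -/
theorem split_frame (h : Scale E k k' c n₁ n₂ m₁ m₂ L) (hk : 2 * k ≤ k') (hc : 2 ^ (n₂ * k') ≤ c)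
    {X₀ X : Finset A} {Y₀ Y : Finset B} {a : Fin n₂ → A} {P : Fin n₂ → Finset B}
    (hF : IsFrame E k' n₂ X₀ Y₀ a P) {i : ℕ} (hL : L (i + 1) X Y) :
    L i (X.filter (Low E k P)) (Y.filter (Above E a)) ∨
      L i (X.filter (Low (co E) k P)) (Y.filter (Above (co E) a)) := by
  set R : Finset B := Finset.univ.biUnion P with hR
  have hRc : R.card ≤ n₂ * k' := by
    simpa using Finset.card_biUnion_le_card_mul Finset.univ P k' fun i _ => (hF.card i).le
  obtain ⟨s, t, X', hX', Y', hY', hL', hs, ht⟩ := h.split_of_mem (fun x => R.filter fun y => E x y)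
    (fun y => Finset.univ.filter fun i => E (a i) y) R.powerset Finset.univ
    (fun x _ => Finset.mem_powerset.2 (Finset.filter_subset _ _)) (fun _ _ => Finset.mem_univ _)
    (by
      rw [Finset.card_powerset]
      exact (Nat.pow_le_pow_right (by norm_num) hRc).trans hc)
    (by
      simp only [Finset.card_univ, Fintype.card_finset, Fintype.card_fin]
      refine (Nat.pow_le_pow_right (by norm_num) ?_).trans hc
      have := h.one_le
      exact Nat.le_mul_of_pos_right _ (by omega)) hL
  rcases h.low_or_high hk hF (s := s) (t := t)
    (fun x hx i y hy => by
      rw [← hs x hx, Finset.mem_filter]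
      exact ⟨fun h => ⟨Finset.mem_biUnion.2 ⟨i, Finset.mem_univ _, hy⟩, h⟩, fun h => h.2⟩)
    (fun y hy i => by rw [← ht y hy, Finset.mem_filter]; simp)
    (h.down_le (Nat.zero_le i) hL') with h1 | h1
  · exact Or.inl (h.mono _ _ _ _ _ hL'
      (fun x hx => Finset.mem_filter.2 ⟨hX' hx, h1.1 x hx⟩)
      (fun y hy => Finset.mem_filter.2 ⟨hY' hy, h1.2 y hy⟩))
  · exact Or.inr (h.mono _ _ _ _ _ hL'
      (fun x hx => Finset.mem_filter.2 ⟨hX' hx, h1.1 x hx⟩)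
      (fun y hy => Finset.mem_filter.2 ⟨hY' hy, h1.2 y hy⟩))

/-- The later centres have at most `n₂ * (k - 1)` neighbours outside the shade of `a`, and cover at
most that many of the `k' ≥ 2 * n₂ * k` leaves in a single `P z`. So shade size is a strictly
decreasing measure of moving after a frame. -/
theorem card_shade_lt_of_after [Fintype B] (h : Scale E k k' c n₁ n₂ m₁ m₂ L)
    (hk : 2 * (n₂ * k) ≤ k') {X : Finset A} {Y : Finset B} {a b : Fin n₂ → A}
    {P : Fin n₂ → Finset B} (hF : IsFrame E k' n₂ X Y a P)
    (hb : ∀ i, Low E k P (b i)) : (shade E b).card < (shade E a).card := by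
  have hn := h.two_le_n₂
  have hk1 := h.one_le
  have hk2 : 2 * k ≤ k' := le_trans (by nlinarith) hk
  let z : Fin n₂ := ⟨0, by omega⟩
  refine card_shade_lt (k := k - 1) (P := (P z).filter fun y => y ∉ shade E b) (fun i => ?_) ?_ ?_
  · have := h.deg_lt_of_isFrame hF (hF.le_deg_co hk2 (hb i))
      (T := Finset.univ.filter fun y => y ∉ shade E a)
      (fun y hy j hj => (Finset.mem_filter.1 hy).2
        (Finset.mem_filter.2 ⟨Finset.mem_univ _, j, hj⟩))
    omega
  · intro y hy
    obtain ⟨h1, h2⟩ := Finset.mem_filter.1 hy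
    exact ⟨Finset.mem_filter.2 ⟨Finset.mem_univ _, z, hF.adj z y h1⟩, h2⟩
  · have h1 : ((P z).filter fun y => ¬ y ∉ shade E b).card ≤ n₂ * (k - 1) := by
      have : ((P z).filter fun y => ¬ y ∉ shade E b) ⊆
          Finset.univ.biUnion fun i => (P z).filter fun y => E (b i) y := by
        intro y hy
        obtain ⟨h1, h2⟩ := Finset.mem_filter.1 hy
        obtain ⟨i, hi⟩ := (Finset.mem_filter.1 (not_not.1 h2)).2
        exact Finset.mem_biUnion.2 ⟨i, Finset.mem_univ _, Finset.mem_filter.2 ⟨h1, hi⟩⟩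
      refine (Finset.card_le_card this).trans ?_
      simpa using Finset.card_biUnion_le_card_mul (Finset.univ : Finset (Fin n₂)) _ (k - 1)
        fun i _ => Nat.le_sub_one_of_lt (hb i z)
    have h2 := Finset.card_filter_add_card_filter_not (s := P z) (fun y => y ∉ shade E b)
    rw [hF.card] at h2
    have h3 : n₂ * (k - 1) < n₂ * k := Nat.mul_lt_mul_of_pos_left (by omega) (by omega)
    omega

/-- The leaves `Q z` lie in the shade of `b` and outside that of `a`, while the centres of `a`
contribute at most `n₂ * (k - 1)` vertices outside the shade of `b`. -/
theorem card_shade_lt_of_before [Fintype B] (h : Scale E k k' c n₁ n₂ m₁ m₂ L)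
    (hk : 2 * (n₂ * k) ≤ k') {X : Finset A} {Y : Finset B} {a b : Fin n₂ → A}
    {Q : Fin n₂ → Finset B} (hG : IsFrame E k' n₂ X Y b Q)
    (hb : ∀ i, ∀ y ∈ Q i, Above (co E) a y) : (shade E a).card < (shade E b).card := by
  have hn := h.two_le_n₂
  have hk1 := h.one_le
  have hnk : n₂ * (k - 1) < n₂ * k := Nat.mul_lt_mul_of_pos_left (by omega) (by omega)
  have hk2 : k ≤ n₂ * k := Nat.le_mul_of_pos_left _ (by omega)
  let z : Fin n₂ := ⟨0, by omega⟩
  refine card_shade_lt (k := k - 1) (P := Q z) (fun i => ?_) ?_ ?_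
  · have := h.deg_lt_of_isFrame hG (x := a i) (fun j => by
        have h1 : deg (co E) (a i) (Q j) = k' := by
          rw [← hG.card j]
          exact congrArg _ (Finset.filter_true_of_mem fun y hy => hb j y hy i)
        omega)
      (T := Finset.univ.filter fun y => y ∉ shade E b)
      (fun y hy j hj => (Finset.mem_filter.1 hy).2
        (Finset.mem_filter.2 ⟨Finset.mem_univ _, j, hj⟩))
    omega
  · intro y hy
    refine ⟨Finset.mem_filter.2 ⟨Finset.mem_univ _, z, hG.adj z y hy⟩, fun h1 => ?_⟩
    obtain ⟨i, hi⟩ := (Finset.mem_filter.1 h1).2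
    exact hb z y hy i hi
  · rw [hG.card]
    omega

/-- A large pair contains two large pairs separated by a frame. -/
theorem exists_separated [Fintype B] (h : Scale E k k' c n₁ n₂ m₁ m₂ L) (hk : 2 * (n₂ * k) ≤ k')
    (hc : 2 ^ (n₂ * k') ≤ c) {i : ℕ} {X : Finset A} {Y : Finset B} (hL : L (i + 3) X Y) :
    ∃ X₁ ⊆ X, ∃ Y₁ ⊆ Y, ∃ X₂ ⊆ X, ∃ Y₂ ⊆ Y, L i X₁ Y₁ ∧ L i X₂ Y₂ ∧ ∀ x ∈ X₂, deg E x Y₁ < k := by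
  have hk2 : 2 * k ≤ k' := le_trans (by have := h.two_le_n₂; nlinarith) hk
  let Fr := (Fin n₂ → A) × (Fin n₂ → Finset B)
  let after : Fr → Prop := fun F => L i (X.filter (Low E k F.2)) (Y.filter (Above E F.1))
  let before : Fr → Prop := fun F =>
    L i (X.filter (Low (co E) k F.2)) (Y.filter (Above (co E) F.1))
  by_contra hno
  -- A frame with large pairs on both sides already separates them, by `deg_lt_of_isFrame`.
  have hboth : ∀ F : Fr, IsFrame E k' n₂ X Y F.1 F.2 → after F → before F → False := by
    intro F hF ha hb
    refine hno ⟨_, Finset.filter_subset _ _, _, Finset.filter_subset _ _, _,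
      Finset.filter_subset _ _, _, Finset.filter_subset _ _, hb, ha, fun x hx => ?_⟩
    exact h.deg_lt_of_isFrame hF (hF.le_deg_co hk2 (Finset.mem_filter.1 hx).2)
      fun y hy => (Finset.mem_filter.1 hy).2
  -- Take a frame of minimal shade with a large part after it. A frame inside that part has smaller
  -- shade, so nothing large comes after it. Largeness after and before is always measured in the
  -- whole pair `(X, Y)` at level `i`.
  have step₁ : ∃ X₁ ⊆ X, ∃ Y₁ ⊆ Y, L (i + 2) X₁ Y₁ ∧
      ∀ F : Fr, IsFrame E k' n₂ X₁ Y₁ F.1 F.2 → ¬ after F := by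
    by_cases hex : ∃ F : Fr, IsFrame E k' n₂ X Y F.1 F.2 ∧ after F
    · obtain ⟨F, ⟨hF, ha⟩, hmin⟩ := exists_minimal_nat _ (fun F : Fr => (shade E F.1).card) hex
      rcases h.split_frame hk2 hc hF hL with h1 | h1
      · refine ⟨_, Finset.filter_subset _ _, _, Finset.filter_subset _ _, h1, fun G hG hGa => ?_⟩
        refine absurd (hmin G ⟨hG.mono (Finset.filter_subset _ _) (Finset.filter_subset _ _), hGa⟩)
          (not_le.2 (h.card_shade_lt_of_after hk hF fun j => ?_))
        exact (Finset.mem_filter.1 (hG.mem j)).2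
      · exact (hboth F hF ha (h.down_le (by omega) h1)).elim
    · exact ⟨X, subset_rfl, Y, subset_rfl, h.down _ _ _ hL, fun F hF ha => hex ⟨F, hF, ha⟩⟩
  obtain ⟨X₁, hX₁, Y₁, hY₁, hL₁, hafter⟩ := step₁
  -- Dually, with maximal shade. A frame inside the resulting pair can have nothing large on either
  -- side, against `split_frame`.
  have step₂ : ∃ X₂ ⊆ X₁, ∃ Y₂ ⊆ Y₁, L (i + 1) X₂ Y₂ ∧
      ∀ F : Fr, IsFrame E k' n₂ X₂ Y₂ F.1 F.2 → ¬ before F := by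
    by_cases hex : ∃ F : Fr, IsFrame E k' n₂ X₁ Y₁ F.1 F.2 ∧ before F
    · obtain ⟨F, ⟨hF, hb⟩, hmin⟩ := exists_minimal_nat _
        (fun F : Fr => Fintype.card B - (shade E F.1).card) hex
      rcases h.split_frame hk2 hc hF hL₁ with h1 | h1
      · refine (hboth F (hF.mono hX₁ hY₁) (h.down_le (Nat.le_succ i) (h.mono _ _ _ _ _ h1 ?_ ?_))
          hb).elim
        · exact Finset.filter_subset_filter _ hX₁
        · exact Finset.filter_subset_filter _ hY₁
      · refine ⟨_, Finset.filter_subset _ _, _, Finset.filter_subset _ _, h1, fun G hG hGb => ?_⟩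
        have h2 := hmin G ⟨hG.mono (Finset.filter_subset _ _) (Finset.filter_subset _ _), hGb⟩
        have h3 := h.card_shade_lt_of_before hk (a := F.1) hG fun j y hy =>
          (Finset.mem_filter.1 (hG.sub j hy)).2
        have h4 := Finset.card_le_univ (shade E G.1)
        omega
    · exact ⟨X₁, subset_rfl, Y₁, subset_rfl, h.down _ _ _ hL₁, fun F hF ha => hex ⟨F, hF, ha⟩⟩
  obtain ⟨X₂, hX₂, Y₂, hY₂, hL₂, hbefore⟩ := step₂
  obtain ⟨a, P, hF⟩ := (h.rich_n₂ _ _ (h.down_le (Nat.zero_le _) hL₂)).exists_isFrame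
  rcases h.split_frame hk2 hc hF (h.down_le (by omega : i + 1 ≤ i + 3) hL) with h1 | h1
  · exact hafter (a, P) (hF.mono hX₂ hY₂) h1
  · exact hbefore (a, P) hF h1

end Scale

/-! ### Chains of large pairs -/

/-- Every vertex of `X` and of `Y` has fewer than `k` neighbours in the other set. -/
def Sparse (E : A → B → Prop) (k : ℕ) (X : Finset A) (Y : Finset B) : Prop :=
  (∀ x ∈ X, deg E x Y < k) ∧ ∀ y ∈ Y, deg (Function.swap E) y X < k

theorem Sparse.mono {E : A → B → Prop} {k : ℕ} {X X' : Finset A} {Y Y' : Finset B}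
    (h : Sparse E k X Y) (hX : X' ⊆ X) (hY : Y' ⊆ Y) : Sparse E k X' Y' :=
  ⟨fun x hx => (deg_mono _ _ hY).trans_lt (h.1 x (hX hx)),
    fun y hy => (deg_mono _ _ hX).trans_lt (h.2 y (hY hy))⟩

/-- The pair `p` precedes the pair `q`: the tops of `q` are almost unrelated to the bottoms of `p`,
and the tops of `p` are related to almost all bottoms of `q`. -/
def Before (E : A → B → Prop) (k : ℕ) (p q : Finset A × Finset B) : Prop :=
  Sparse E k q.1 p.2 ∧ Sparse (co E) k p.1 q.2

theorem Before.mono {E : A → B → Prop} {k : ℕ} {p q p' q' : Finset A × Finset B}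
    (h : Before E k p q) (h₁ : p'.1 ⊆ p.1) (h₂ : p'.2 ⊆ p.2) (h₃ : q'.1 ⊆ q.1) (h₄ : q'.2 ⊆ q.2) :
    Before E k p' q' :=
  ⟨h.1.mono h₃ h₂, h.2.mono h₁ h₄⟩

namespace Scale

variable {E : A → B → Prop} {k k' c n₁ n₂ m₁ m₂ : ℕ} {L : ℕ → Finset A → Finset B → Prop}

/-- Separation bounds only the degrees of tops. To bound those of bottoms, separate twice and test
each bottom of the first pair against the middle pair `(X₂, Y₂)`: if it is unrelated to a large part
there, it has few neighbours in `X₃`. If most bottoms failed the test, `k` of them would have a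
common neighbour in `X₂`, contradicting the first separation. -/
theorem exists_sparse [Fintype B] (h : Scale E k k' c n₁ n₂ m₁ m₂ L) (hk : 2 * (n₂ * k) ≤ k')
    (hc : 2 ^ (n₂ * k') ≤ c) {i : ℕ} (hi : 3 ≤ i) {X : Finset A} {Y : Finset B}
    (hL : L (i + 7) X Y) :
    ∃ X₁ ⊆ X, ∃ Y₁ ⊆ Y, ∃ X₂ ⊆ X, ∃ Y₂ ⊆ Y, L i X₁ Y₁ ∧ L i X₂ Y₂ ∧ Sparse E k X₂ Y₁ := by
  obtain ⟨X₁, hX₁, Y₁, hY₁, X', hX', Y', hY', h₁, h', hs⟩ := h.exists_separated hk hc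
    (i := i + 4) hL
  obtain ⟨X₂, hX₂, Y₂, hY₂, X₃, hX₃, Y₃, hY₃, h₂, h₃, hs'⟩ := h.exists_separated hk hc
    (i := i) (h.down _ _ _ h')
  rcases h.split_right (fun y => L 1 (X₂.filter fun x => ¬ E x y) Y₂) h₁ with h4 | h4
  · refine ⟨X₁, hX₁, _, (Finset.filter_subset _ _).trans hY₁, X₃, hX₃.trans hX', Y₃,
      hY₃.trans hY', h.down_le (by omega) h4, h₃, fun x hx => ?_, fun y hy => ?_⟩
    · exact (deg_mono _ _ (Finset.filter_subset _ _)).trans_lt (hs x (hX₃ hx))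
    · exact h.deg_swap_lt (Finset.mem_filter.1 hy).2 hs'
  · exfalso
    have hcc := h.add_two_le
    have hcard := h.card_right _ _ (h.down_le (Nat.zero_le _) h4)
    obtain ⟨S, hS, hSc⟩ := Finset.exists_subset_card_eq (le_trans (by omega : k ≤ c) hcard.le)
    have hS' := fun y (hy : y ∈ S) => Finset.mem_filter.1 (hS hy)
    obtain ⟨Z, hZ, h5, hZS⟩ := h.exists_large_common (h.down_le (by omega : 2 ≤ i) h₂) hSc.le
      fun y hy => (hS' y hy).2
    obtain ⟨x, hx⟩ := Finset.card_pos.1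
      ((Nat.zero_le _).trans_lt (h.card_left _ _ (h.down _ _ _ h5)))
    refine absurd (hs x (hX₂ (hZ hx))) (not_lt.2 ?_)
    rw [← hSc]
    exact Finset.card_le_card fun y hy => Finset.mem_filter.2 ⟨(hS' y hy).1, hZS x hx y hy⟩

theorem not_large_of_deg_lt (h : Scale E k k' c n₁ n₂ m₁ m₂ L) {X : Finset A} {Y : Finset B}
    (hd : ∀ x ∈ X, deg E x Y < k) : ¬ L 0 X Y := by
  intro hL
  have h1 := (h.rich_n₂ _ _ hL).mono_copies (n := 1) (by have := h.two_le_n₂; omega)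
  obtain ⟨a, ha, P, hP, hPc, hE, -⟩ := h1
  have h2 : P.card ≤ deg E a Y :=
    Finset.card_le_card fun y hy => Finset.mem_filter.2 ⟨hP hy, hE y hy⟩
  have := hd a ha
  have := h.le_fat
  omega

/-- A middle pair again mediates. Tops of the first pair unrelated to a large part of it would have
few neighbours in `Y₁`, so they do not form a large pair with `Y₁` and can be dropped; likewise for
the bottoms of the last pair. What remains is almost complete by `deg_co_lt_of_not_large`. -/
theorem exists_before [Fintype B] (h : Scale E k k' c n₁ n₂ m₁ m₂ L) (hk : 2 * (n₂ * k) ≤ k')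
    (hc : 2 ^ (n₂ * k') ≤ c) {i : ℕ} (hi : 3 ≤ i) {X : Finset A} {Y : Finset B}
    (hL : L (i + 16) X Y) :
    ∃ X₁ ⊆ X, ∃ Y₁ ⊆ Y, ∃ X₂ ⊆ X, ∃ Y₂ ⊆ Y, L i X₁ Y₁ ∧ L i X₂ Y₂ ∧
      Before E k (X₁, Y₁) (X₂, Y₂) := by
  obtain ⟨X₁, hX₁, Y₁, hY₁, X', hX', Y', hY', h₁, h', hs⟩ := h.exists_sparse hk hc
    (i := i + 8) (by omega) (h.down _ _ _ hL)
  obtain ⟨X₂, hX₂, Y₂, hY₂, X₃, hX₃, Y₃, hY₃, h₂, h₃, hs'⟩ := h.exists_sparse hk hc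
    (i := i + 1) (by omega) h'
  have h₄ : L i (X₁.filter fun x => ¬ L 1 X₂ (Y₂.filter fun y => ¬ E x y)) Y₁ := by
    rcases h.split_left (fun x => L 1 X₂ (Y₂.filter fun y => ¬ E x y)) h₁ with h4 | h4
    · refine (h.not_large_of_deg_lt (fun x hx => ?_) (h.down_le (Nat.zero_le _) h4)).elim
      exact h.deg_lt (Finset.mem_filter.1 hx).2 (hs.mono hX₂ subset_rfl).2
    · exact h.down_le (by omega) h4
  have h₅ : L i X₃ (Y₃.filter fun y => ¬ L 1 (X₂.filter fun x => ¬ E x y) Y₂) := by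
    rcases h.split_right (fun y => L 1 (X₂.filter fun x => ¬ E x y) Y₂) h₃ with h4 | h4
    · refine (h.flip.not_large_of_deg_lt (fun x hx => ?_) (h.down_le (Nat.zero_le _) h4)).elim
      exact h.deg_swap_lt (Finset.mem_filter.1 hx).2 hs'.1
    · exact h4
  have h₂' := h.down_le (by omega : 3 ≤ i + 1) h₂
  refine ⟨_, (Finset.filter_subset _ _).trans hX₁, Y₁, hY₁, X₃, hX₃.trans hX', _,
    (Finset.filter_subset _ _).trans (hY₃.trans hY'), h₄, h₅, hs.mono hX₃ subset_rfl,
    fun x hx => ?_, fun y hy => ?_⟩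
  · exact h.deg_co_lt_of_not_large h₂' (Finset.mem_filter.1 hx).2
      fun y hy => (Finset.mem_filter.1 hy).2
  · exact h.deg_co_swap_lt_of_not_large h₂' (Finset.mem_filter.1 hy).2
      fun x hx => (Finset.mem_filter.1 hx).2

theorem exists_chain [Fintype B] (h : Scale E k k' c n₁ n₂ m₁ m₂ L) (hk : 2 * (n₂ * k) ≤ k')
    (hc : 2 ^ (n₂ * k') ≤ c) (m : ℕ) {X : Finset A} {Y : Finset B} (hL : L (3 + 16 * m) X Y) :
    ∃ l : List (Finset A × Finset B), l.length = 2 ^ m ∧ l.Pairwise (Before E k) ∧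
      ∀ p ∈ l, p.1 ⊆ X ∧ p.2 ⊆ Y ∧ L 3 p.1 p.2 := by
  induction m generalizing X Y with
  | zero => exact ⟨[(X, Y)], by simp, by simp, by simpa using hL⟩
  | succ m ih =>
    obtain ⟨X₁, hX₁, Y₁, hY₁, X₂, hX₂, Y₂, hY₂, h₁, h₂, hb⟩ := h.exists_before hk hc
      (i := 3 + 16 * m) (by omega) hL
    obtain ⟨l₁, hc₁, hp₁, hl₁⟩ := ih h₁
    obtain ⟨l₂, hc₂, hp₂, hl₂⟩ := ih h₂
    refine ⟨l₁ ++ l₂, by simp [hc₁, hc₂, pow_succ]; omega, List.pairwise_append.2 ⟨hp₁, hp₂, ?_⟩, ?_⟩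
    · intro p hp q hq
      exact hb.mono (hl₁ p hp).1 (hl₁ p hp).2.1 (hl₂ q hq).1 (hl₂ q hq).2.1
    · intro p hp
      rcases List.mem_append.1 hp with hp | hp
      · exact ⟨(hl₁ p hp).1.trans hX₁, (hl₁ p hp).2.1.trans hY₁, (hl₁ p hp).2.2⟩
      · exact ⟨(hl₂ p hp).1.trans hX₂, (hl₂ p hp).2.1.trans hY₂, (hl₂ p hp).2.2⟩

end Scale

/-! ### Positions relative to a longest chain -/

namespace Scale

variable {E : A → B → Prop} {k k' c n₁ n₂ m₁ m₂ : ℕ} {L : ℕ → Finset A → Finset B → Prop}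

theorem two_mul_le (h : Scale E k k' c n₁ n₂ m₁ m₂ L) : 2 * k ≤ c := by
  have h1 := h.sq_le
  have h2 := h.add_two_le
  by_cases hk : k ≤ 2
  · omega
  · nlinarith

theorem not_large_filter (h : Scale E k k' c n₁ n₂ m₁ m₂ L) {X : Finset A} {Y : Finset B} {x : A}
    (hd : deg E x Y < k) : ¬ L 1 X (Y.filter fun y => E x y) := by
  intro hL
  have h1 := h.card_right _ _ (h.down _ _ _ hL)
  have h2 := h.add_two_le
  unfold deg at hd
  omega

theorem not_large_filter_not (h : Scale E k k' c n₁ n₂ m₁ m₂ L) {X : Finset A} {Y : Finset B}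
    {x : A} (hd : deg (co E) x Y < k) : ¬ L 1 X (Y.filter fun y => ¬ E x y) := by
  have h1 := h.compl.not_large_filter (X := X) hd
  convert h1

/-- Once `x` is related to a large part of one pair, it misses fewer than `k` bottoms of each later
pair. So the behaviour of `x` along the chain switches only once. -/
theorem exists_top_position (h : Scale E k k' c n₁ n₂ m₁ m₂ L) {N : ℕ}
    {F : ℕ → Finset A × Finset B} (hB : ∀ i j, i < j → j < N → Before E k (F i) (F j))
    (hL : ∀ i < N, L 3 (F i).1 (F i).2) (x : A) :
    ∃ j ≤ N, (∀ i < j, L 1 (F i).1 ((F i).2.filter fun y => ¬ E x y)) ∧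
      ∀ i, j ≤ i → i < N → L 1 (F i).1 ((F i).2.filter fun y => E x y) := by
  have hex : ∃ j, N ≤ j ∨ L 1 (F j).1 ((F j).2.filter fun y => E x y) := ⟨N, Or.inl le_rfl⟩
  have hor : ∀ i < N, L 1 (F i).1 ((F i).2.filter fun y => E x y) ∨
      L 1 (F i).1 ((F i).2.filter fun y => ¬ E x y) := fun i hi =>
    h.split_right (fun y => E x y) (h.down _ _ _ (hL i hi))
  refine ⟨Nat.find hex, Nat.find_min' hex (Or.inl le_rfl), fun i hi => ?_, fun i hi hiN => ?_⟩
  · have h1 := Nat.find_min hex hi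
    push Not at h1
    exact (hor i h1.1).resolve_left h1.2
  · have h1 := (Nat.find_spec hex).resolve_left (by omega)
    rcases hi.eq_or_lt with heq | hlt
    · exact heq ▸ h1
    · refine (hor i hiN).resolve_right fun h2 => ?_
      have h3 := h.deg_co_lt h1 (hB _ _ hlt hiN).2.2
      exact h.not_large_filter_not h3 h2

theorem exists_bottom_position (h : Scale E k k' c n₁ n₂ m₁ m₂ L) {N : ℕ}
    {F : ℕ → Finset A × Finset B} (hB : ∀ i j, i < j → j < N → Before E k (F i) (F j))
    (hL : ∀ i < N, L 3 (F i).1 (F i).2) (y : B) :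
    ∃ j ≤ N, (∀ i < j, L 1 ((F i).1.filter fun x => E x y) (F i).2) ∧
      ∀ i, j ≤ i → i < N → L 1 ((F i).1.filter fun x => ¬ E x y) (F i).2 := by
  obtain ⟨j, hj, h1, h2⟩ := h.compl.flip.exists_top_position (N := N) (F := fun i => ((F i).2, (F i).1))
    (fun i j hij hj => ⟨⟨(hB i j hij hj).2.2, (hB i j hij hj).2.1⟩, by
      have h1 := (hB i j hij hj).1
      change Sparse (co (co (Function.swap E))) _ _ _
      rw [co_co]
      exact ⟨h1.2, h1.1⟩⟩) hL y
  refine ⟨j, hj, fun i hi => ?_, fun i hi hiN => ?_⟩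
  · have h3 := h1 i hi
    simp only [_root_.flip, co, not_not] at h3
    convert h3
  · have he : ((F i).1.filter fun x => ¬ E x y) =
        (F i).1.filter fun x => _root_.flip (co E) y x :=
      Finset.filter_congr fun _ _ => Iff.rfl
    rw [he]
    exact h2 i hi hiN

/-- The vertices have positions with respect to a chain of large pairs of maximal length. -/
theorem exists_positions [Fintype A] [Fintype B] (h : Scale E k k' c n₁ n₂ m₁ m₂ L)
    (hk : 2 * (n₂ * k) ≤ k') (hc : 2 ^ (n₂ * k') ≤ c) :
    ∃ (f : A → ℕ) (g : B → ℕ),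
      (∀ X Y, (∀ x ∈ X, ∀ y ∈ Y, g y + 2 ≤ f x) → Sparse E k X Y) ∧
      (∀ X Y, (∀ x ∈ X, ∀ y ∈ Y, f x + 2 ≤ g y) → Sparse (co E) k X Y) ∧
      ∀ a b X Y, a ≤ b + 1 → b ≤ a + 1 → (∀ x ∈ X, f x = a) → (∀ y ∈ Y, g y = b) →
        ¬ L 51 X Y := by
  have hk1 := h.one_le
  -- Chain lengths are bounded because chains have no repetitions: in a pair that precedes itself, a
  -- top would have fewer than `k` neighbours and fewer than `k` non-neighbours among more than `c ≥
  -- 2 * k` bottoms.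
  obtain ⟨l, ⟨hl, hlL⟩, hmax⟩ := exists_minimal_nat
    (fun l : List (Finset A × Finset B) => l.Pairwise (Before E k) ∧ ∀ p ∈ l, L 3 p.1 p.2)
    (fun l => Fintype.card (Finset A × Finset B) - l.length) ⟨[], by simp, by simp⟩
  have hmax' : ∀ l' : List (Finset A × Finset B), l'.Pairwise (Before E k) →
      (∀ p ∈ l', L 3 p.1 p.2) → l'.length ≤ l.length := by
    intro l' hl' hlL'
    have h1 := hmax l' ⟨hl', hlL'⟩
    have hnd : l'.Nodup := by
      refine List.Pairwise.imp_of_mem (fun {p q} hp _ hpq hne => ?_) hl'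
      subst hne
      have h0 := h.down_le (Nat.zero_le _) (hlL' p hp)
      obtain ⟨x, hx⟩ := Finset.card_pos.1 ((Nat.zero_le _).trans_lt (h.card_left _ _ h0))
      have h2 := h.card_right _ _ h0
      have h3 := hpq.1.1 x hx
      have h4 := hpq.2.1 x hx
      have h5 := deg_add_deg_co E x p.2
      have h6 := h.two_mul_le
      omega
    have h2 := hnd.length_le_card
    omega
  set N := l.length with hN
  set F : ℕ → Finset A × Finset B := fun i => (l[i]?).getD (∅, ∅) with hF
  have hFl : ∀ i (hi : i < l.length), F i = l[i] := fun i hi => by simp [hF, hi]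
  have hB : ∀ i j, i < j → j < N → Before E k (F i) (F j) := by
    intro i j hij hj
    rw [hFl i (hij.trans hj), hFl j hj]
    exact List.pairwise_iff_getElem.1 hl i j (hij.trans hj) hj hij
  have hL : ∀ i < N, L 3 (F i).1 (F i).2 := by
    intro i hi
    rw [hFl i hi]
    exact hlL _ (List.getElem_mem hi)
  choose f hfN hflo hfhi using h.exists_top_position hB hL
  choose g hgN hghi hglo using h.exists_bottom_position hB hL
  -- A gap of two leaves two consecutive pairs of the chain between the positions: one bounds the
  -- degrees of the given vertices into the other, and the other transfers the bound to the opposite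
  -- vertex.
  have far : ∀ X Y, (∀ x ∈ X, ∀ y ∈ Y, g y + 2 ≤ f x) → Sparse E k X Y := by
    intro X Y hXY
    refine ⟨fun x hx => ?_, fun y hy => ?_⟩
    · rcases Y.eq_empty_or_nonempty with rfl | ⟨y₀, hy₀⟩
      · simp only [deg, Finset.filter_empty, Finset.card_empty]; omega
      · have h0 := hXY x hx y₀ hy₀
        have h1 := hfN x
        refine h.deg_lt (hflo x (f x - 1) (by omega)) fun y hy => ?_
        have h2 := hXY x hx y hy
        exact h.deg_swap_lt (hglo y (f x - 2) (by omega) (by omega))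
          (hB (f x - 2) (f x - 1) (by omega) (by omega)).1.1
    · rcases X.eq_empty_or_nonempty with rfl | ⟨x₀, hx₀⟩
      · simp only [deg, Finset.filter_empty, Finset.card_empty]; omega
      · have h0 := hXY x₀ hx₀ y hy
        have h1 := hfN x₀
        refine h.deg_swap_lt (hglo y (g y) le_rfl (by omega)) fun x hx => ?_
        have h2 := hXY x hx y hy
        exact h.deg_lt (hflo x (g y + 1) (by omega))
          (hB (g y) (g y + 1) (by omega) (by omega)).1.2
  have far' : ∀ X Y, (∀ x ∈ X, ∀ y ∈ Y, f x + 2 ≤ g y) → Sparse (co E) k X Y := by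
    intro X Y hXY
    refine ⟨fun x hx => ?_, fun y hy => ?_⟩
    · rcases Y.eq_empty_or_nonempty with rfl | ⟨y₀, hy₀⟩
      · simp only [deg, Finset.filter_empty, Finset.card_empty]; omega
      · have h0 := hXY x hx y₀ hy₀
        have h1 := hgN y₀
        refine h.deg_co_lt (hfhi x (f x) le_rfl (by omega)) fun y hy => ?_
        have h2 := hXY x hx y hy
        exact h.deg_co_swap_lt (hghi y (f x + 1) (by omega))
          (hB (f x) (f x + 1) (by omega) (by omega)).2.1
    · rcases X.eq_empty_or_nonempty with rfl | ⟨x₀, hx₀⟩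
      · simp only [deg, Finset.filter_empty, Finset.card_empty]; omega
      · have h0 := hXY x₀ hx₀ y hy
        have h1 := hgN y
        refine h.deg_co_swap_lt (hghi y (g y - 1) (by omega)) fun x hx => ?_
        have h2 := hXY x hx y hy
        exact h.deg_co_lt (hfhi x (g y - 2) (by omega) (by omega))
          (hB (g y - 2) (g y - 1) (by omega) (by omega)).2.2
  have hfF : ∀ i < N, ∀ x ∈ (F i).1, i ≤ f x ∧ f x ≤ i + 1 := by
    intro i hi x hx
    have h1 := hfN x
    constructor
    · by_contra! hlt
      exact h.not_large_filter ((hB (i - 1) i (by omega) hi).1.1 x hx)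
        (hfhi x (i - 1) (by omega) (by omega))
    · by_contra! hlt
      exact h.not_large_filter_not ((hB i (i + 1) (by omega) (by omega)).2.1 x hx)
        (hflo x (i + 1) (by omega))
  have hgF : ∀ i < N, ∀ y ∈ (F i).2, i ≤ g y ∧ g y ≤ i + 1 := by
    intro i hi y hy
    have h1 := hgN y
    constructor
    · by_contra! hlt
      exact h.flip.not_large_filter_not ((hB (i - 1) i (by omega) hi).2.2 y hy)
        (hglo y (i - 1) (by omega) (by omega))
    · by_contra! hlt
      exact h.flip.not_large_filter ((hB i (i + 1) (by omega) (by omega)).1.2 y hy)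
        (hghi y (i + 1) (by omega))
  refine ⟨f, g, far, far', fun a b X Y hab hba hX hY hXY => ?_⟩
  have haN : a ≤ N := by
    obtain ⟨x, hx⟩ := Finset.card_pos.1
      ((Nat.zero_le _).trans_lt (h.card_left _ _ (h.down_le (Nat.zero_le _) hXY)))
    exact hX x hx ▸ hfN x
  obtain ⟨H, hHc, hHp, hH⟩ := h.exists_chain hk hc 3 hXY
  have htake : ∀ p ∈ l.take (a - 3), ∃ i, i + 4 ≤ a ∧ i < N ∧ p = F i := by
    intro p hp
    obtain ⟨i, hi, rfl⟩ := List.mem_take_iff_getElem.1 hp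
    exact ⟨i, by omega, by omega, (hFl i (by omega)).symm⟩
  have hdrop : ∀ p ∈ l.drop (a + 3), ∃ i, a + 3 ≤ i ∧ i < N ∧ p = F i := by
    intro p hp
    obtain ⟨i, hi, rfl⟩ := List.mem_drop_iff_getElem.1 hp
    exact ⟨a + 3 + i, by omega, by omega, (hFl _ (by omega)).symm⟩
  -- At most six pairs of the chain, those within distance three of `a`, are replaced by the eight
  -- pairs of `H`; the kept pairs are far enough for `far` and `far'`.
  have hlen := hmax' (l.take (a - 3) ++ (H ++ l.drop (a + 3))) ?_ ?_
  · simp only [List.length_append, List.length_take, List.length_drop, hHc] at hlen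
    omega
  · refine List.pairwise_append.2 ⟨hl.sublist (List.take_sublist _ _),
      List.pairwise_append.2 ⟨hHp, hl.sublist (List.drop_sublist _ _), ?_⟩, ?_⟩
    · intro q hq p hp
      obtain ⟨i, hi, hiN, rfl⟩ := hdrop p hp
      obtain ⟨hq1, hq2, -⟩ := hH q hq
      refine ⟨far _ _ fun x hx y hy => ?_, far' _ _ fun x hx y hy => ?_⟩
      · have := hfF i hiN x hx
        have := hY y (hq2 hy)
        omega
      · have := hgF i hiN y hy
        have := hX x (hq1 hx)
        omega
    · intro p hp q hq
      obtain ⟨i, hi, hiN, rfl⟩ := htake p hp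
      rcases List.mem_append.1 hq with hq | hq
      · obtain ⟨hq1, hq2, -⟩ := hH q hq
        refine ⟨far _ _ fun x hx y hy => ?_, far' _ _ fun x hx y hy => ?_⟩
        · have := hgF i hiN y hy
          have := hX x (hq1 hx)
          omega
        · have := hfF i hiN x hx
          have := hY y (hq2 hy)
          omega
      · obtain ⟨j, hj, hjN, rfl⟩ := hdrop q hq
        exact hB i j (by omega) hjN
  · intro p hp
    rcases List.mem_append.1 hp with hp | hp
    · exact hlL p (List.mem_of_mem_take hp)
    · rcases List.mem_append.1 hp with hp | hp
      · exact (hH p hp).2.2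
      · exact hlL p (List.mem_of_mem_drop hp)

end Scale

/-! ### Good colourings and how they combine -/

/-- `X` and `Y` have colourings with `r` colours such that the neighbourhoods of the vertices of any
colour class of `X` in any colour class of `Y` form a near-chain. -/
def Good (E : A → B → Prop) (K r : ℕ) (X : Finset A) (Y : Finset B) : Prop :=
  ∃ (f : A → ℕ) (g : B → ℕ), (∀ x, f x < r) ∧ (∀ y, g y < r) ∧
    ∀ i j, NearChain E K (X.filter fun x => f x = i) (Y.filter fun y => g y = j)

theorem Good.mono {E : A → B → Prop} {K K' r r' : ℕ} {X X' : Finset A} {Y Y' : Finset B}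
    (h : Good E K r X Y) (hK : K ≤ K') (hr : r ≤ r') (hX : X' ⊆ X) (hY : Y' ⊆ Y) :
    Good E K' r' X' Y' := by
  obtain ⟨f, g, hf, hg, h⟩ := h
  exact ⟨f, g, fun x => (hf x).trans_le hr, fun y => (hg y).trans_le hr, fun i j =>
    (h i j).mono (Finset.filter_subset_filter _ hX) (Finset.filter_subset_filter _ hY) hK⟩

theorem NearChain.good {E : A → B → Prop} {K : ℕ} {X : Finset A} {Y : Finset B}
    (h : NearChain E K X Y) : Good E K 1 X Y :=
  ⟨fun _ => 0, fun _ => 0, fun _ => one_pos, fun _ => one_pos, fun _ _ =>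
    h.mono (Finset.filter_subset _ _) (Finset.filter_subset _ _) le_rfl⟩

theorem nearChain_of_card_lt {E : A → B → Prop} {K : ℕ} {X : Finset A} {Y : Finset B}
    (h : Y.card < K) : NearChain E K X Y :=
  fun _ _ _ _ => Or.inl ((Finset.card_filter_le _ _).trans_lt h)

theorem excess_self (E : A → B → Prop) (x : A) (Y : Finset B) : excess E x x Y = 0 := by
  simp [excess]

theorem good_of_colouring {E : A → B → Prop} {K r : ℕ} (hK : 1 ≤ K) {X : Finset A} {Y : Finset B}
    {α β : Type*} [Fintype α] [Fintype β] (hα : Fintype.card α ≤ r) (hβ : Fintype.card β ≤ r)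
    (f : A → α) (g : B → β)
    (h : ∀ i j, ∀ X' ⊆ X, ∀ Y' ⊆ Y, (∀ x ∈ X', f x = i) → (∀ y ∈ Y', g y = j) →
      NearChain E K X' Y') : Good E K r X Y := by
  refine ⟨fun x => Fintype.equivFin α (f x), fun y => Fintype.equivFin β (g y),
    fun x => (Fin.is_lt _).trans_le hα, fun y => (Fin.is_lt _).trans_le hβ, fun i j => ?_⟩
  rcases (Y.filter fun y => (Fintype.equivFin β (g y) : ℕ) = j).eq_empty_or_nonempty with he | ⟨y, hy⟩
  · rw [he]
    exact nearChain_of_card_lt (by rw [Finset.card_empty]; omega)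
  · have hy1 := (Finset.mem_filter.1 hy).2
    intro x hx x' hx'
    have hx1 := (Finset.mem_filter.1 hx).2
    refine h (f x) (g y) _ (Finset.filter_subset _ _) _ (Finset.filter_subset _ _) ?_ ?_ x hx x' hx'
    · intro z hz
      exact (Fintype.equivFin α).injective
        (Fin.ext ((Finset.mem_filter.1 hz).2.trans hx1.symm))
    · intro z hz
      exact (Fintype.equivFin β).injective
        (Fin.ext ((Finset.mem_filter.1 hz).2.trans hy1.symm))

theorem good_of_card_left {E : A → B → Prop} {K r : ℕ} (hK : 1 ≤ K) {X : Finset A} {Y : Finset B}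
    (hX : X.card < r) : Good E K r X Y := by
  refine good_of_colouring hK (α := Option X) (β := Unit) (by simpa using hX) (by simp; omega)
    (fun x => if h : x ∈ X then some ⟨x, h⟩ else none) (fun _ => ()) ?_
  intro i j X' hX' Y' _ hi _ x hx x' hx'
  have h1 := (hi x hx).trans (hi x' hx').symm
  simp only [dif_pos (hX' hx), dif_pos (hX' hx'), Option.some.injEq, Subtype.mk.injEq] at h1
  subst h1
  left
  rw [excess_self]
  exact hK

/-- Good colourings of all pairs of pieces of `X` and of `Y` combine to a good colouring. -/
theorem good_of_pieces {E : A → B → Prop} {K c r : ℕ} (hK : 1 ≤ K) {X : Finset A} {Y : Finset B}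
    (p : A → ℕ) (q : B → ℕ) (hp : ∀ x, p x < c) (hq : ∀ y, q y < c)
    (h : ∀ s t, Good E K r (X.filter fun x => p x = s) (Y.filter fun y => q y = t)) :
    Good E K (c * r ^ c) X Y := by
  choose F G hF hG hFG using h
  -- A vertex remembers its piece and its colour relative to each of the `c` pieces of the other
  -- side.
  refine good_of_colouring hK (α := Fin c × (Fin c → Fin r)) (β := Fin c × (Fin c → Fin r))
    (by simp) (by simp)
    (fun x => (⟨p x, hp x⟩, fun t => ⟨F (p x) t x, hF _ _ _⟩))
    (fun y => (⟨q y, hq y⟩, fun s => ⟨G s (q y) y, hG _ _ _⟩)) ?_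
  rintro ⟨s, φ⟩ ⟨t, ψ⟩ X' hX' Y' hY' hi hj
  refine (hFG s t (φ t) (ψ s)).mono ?_ ?_ le_rfl
  · intro x hx
    have h1 := hi x hx
    rw [Prod.mk.injEq] at h1
    obtain ⟨rfl, rfl⟩ := h1
    exact Finset.mem_filter.2 ⟨Finset.mem_filter.2 ⟨hX' hx, rfl⟩, rfl⟩
  · intro y hy
    have h1 := hj y hy
    rw [Prod.mk.injEq] at h1
    obtain ⟨rfl, rfl⟩ := h1
    exact Finset.mem_filter.2 ⟨Finset.mem_filter.2 ⟨hY' hy, rfl⟩, rfl⟩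

theorem excess_le_add (E : A → B → Prop) (x x' : A) {Y Y₁ Y₂ : Finset B}
    (h : ∀ y ∈ Y, y ∈ Y₁ ∨ y ∈ Y₂) : excess E x x' Y ≤ excess E x x' Y₁ + excess E x x' Y₂ := by
  refine (Finset.card_le_card ?_).trans (Finset.card_union_le _ _)
  intro y hy
  rw [Finset.mem_filter] at hy
  rw [Finset.mem_union, Finset.mem_filter, Finset.mem_filter]
  exact (h y hy.1).imp (fun h => ⟨h, hy.2⟩) fun h => ⟨h, hy.2⟩

/-- The number next to `a`, or equal to it, of residue `t`. -/
def near (a t : ℕ) : ℕ := if a % 3 = t then a else if (a + 1) % 3 = t then a + 1 else a - 1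

theorem near_mod {a b : ℕ} (h₁ : a ≤ b + 1) (h₂ : b ≤ a + 1) : near a (b % 3) = b := by
  unfold near
  split_ifs <;> omega

/-- If the vertices have positions at which far pairs are sparse or almost complete, then good colourings
of the pairs of vertices at near positions combine to a good colouring of the whole graph. -/
theorem good_of_positions [Fintype A] [Fintype B] {E : A → B → Prop} {K k r : ℕ} (hK : 1 ≤ K)
    (f : A → ℕ) (g : B → ℕ)
    (hlow : ∀ X Y, (∀ x ∈ X, ∀ y ∈ Y, g y + 2 ≤ f x) → Sparse E k X Y)
    (hhigh : ∀ X Y, (∀ x ∈ X, ∀ y ∈ Y, f x + 2 ≤ g y) → Sparse (co E) k X Y)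
    (hmid : ∀ a b, Good E K r (Finset.univ.filter fun x => f x = a)
      (Finset.univ.filter fun y => g y = b ∧ a ≤ b + 1 ∧ b ≤ a + 1)) :
    Good E (K + 2 * k) (3 * r ^ 3) (Finset.univ : Finset A) (Finset.univ : Finset B) := by
  choose F G hF hG hFG using hmid
  have hexlow : ∀ x x' (Y : Finset B), (∀ y ∈ Y, g y + 2 ≤ f x) → excess E x x' Y < k :=
    fun x x' Y hY => (excess_le_deg E x x' Y).trans_lt
      ((hlow {x} Y (by simpa using hY)).1 x (by simp))
  have hexhigh : ∀ x x' (Y : Finset B), (∀ y ∈ Y, f x' + 2 ≤ g y) → excess E x x' Y < k :=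
    fun x x' Y hY => by
      rw [← excess_co]
      exact (excess_le_deg _ x' x Y).trans_lt
        ((hhigh {x'} Y (by simpa using hY)).1 x' (by simp))
  -- A vertex remembers its position modulo 3 and its colours relative to the three near positions,
  -- which are told apart by their residues.
  refine good_of_colouring (by omega) (α := Fin 3 × (Fin 3 → Fin r))
    (β := Fin 3 × (Fin 3 → Fin r)) (by simp) (by simp)
    (fun x => (⟨f x % 3, Nat.mod_lt _ (by omega)⟩, fun t => ⟨F (f x) (near (f x) t) x, hF _ _ _⟩))
    (fun y => (⟨g y % 3, Nat.mod_lt _ (by omega)⟩, fun s => ⟨G (near (g y) s) (g y) y, hG _ _ _⟩)) ?_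
  rintro ⟨s, φ⟩ ⟨t, ψ⟩ X' - Y' - hi hj
  have hX : ∀ x ∈ X', f x % 3 = s ∧ F (f x) (near (f x) t) x = φ t := by
    intro x hx
    have h1 := hi x hx
    rw [Prod.mk.injEq] at h1
    obtain ⟨rfl, rfl⟩ := h1
    exact ⟨rfl, rfl⟩
  have hY : ∀ y ∈ Y', g y % 3 = t ∧ G (near (g y) s) (g y) y = ψ s := by
    intro y hy
    have h1 := hj y hy
    rw [Prod.mk.injEq] at h1
    obtain ⟨rfl, rfl⟩ := h1
    exact ⟨rfl, rfl⟩
  -- Different positions of equal residue differ by at least three, so each bottom is far below `x'`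
  -- or far above `x`. The former contribute fewer than `k` neighbours of `x'`, the latter fewer
  -- than `k` non-neighbours of `x`.
  have hlt : ∀ x x', f x + 2 < f x' → excess E x' x Y' < K + 2 * k := by
    intro x x' hxx
    have h1 := excess_le_add E x' x (Y := Y') (Y₁ := Y'.filter fun y => g y + 2 ≤ f x')
      (Y₂ := Y'.filter fun y => f x + 2 ≤ g y) (fun y hy => by
        simp only [Finset.mem_filter, hy, true_and]; omega)
    have h2 := hexlow x' x (Y'.filter fun y => g y + 2 ≤ f x')
      fun y hy => (Finset.mem_filter.1 hy).2
    have h3 := hexhigh x' x (Y'.filter fun y => f x + 2 ≤ g y)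
      fun y hy => (Finset.mem_filter.1 hy).2
    omega
  intro x hx x' hx'
  have hs := (hX x hx).1
  have hs' := (hX x' hx').1
  rcases lt_trichotomy (f x) (f x') with hff | hff | hff
  · exact Or.inr (hlt x x' (by omega))
  · obtain ⟨a, ha⟩ : ∃ a, f x = a := ⟨_, rfl⟩
    have ha' : f x' = a := by omega
    have h1 := hFG a (near a t) (φ t) (ψ s) x (by
        simpa [ha] using (hX x hx).2) x' (by simpa [ha'] using (hX x' hx').2)
    -- At equal positions, far bottoms cost `2 * k` in total, and the near ones all lie at the
    -- single position `near a t`, where the good colouring gives `K`.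
    have key : ∀ z z', f z = a → f z' = a → excess E z z' ((Finset.univ.filter fun y =>
        g y = near a t ∧ a ≤ near a t + 1 ∧ near a t ≤ a + 1).filter fun y =>
          G a (near a t) y = ψ s) < K → excess E z z' Y' < K + 2 * k := by
      intro z z' hz hz' hlt
      have h2 := excess_le_add E z z' (Y := Y') (Y₁ := Y'.filter fun y => g y + 2 ≤ a)
        (Y₂ := Y'.filter fun y => a < g y + 2) (fun y hy => by
          simp only [Finset.mem_filter, hy, true_and]; omega)
      have h3 := excess_le_add E z z' (Y := Y'.filter fun y => a < g y + 2)
        (Y₁ := Y'.filter fun y => a + 2 ≤ g y)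
        (Y₂ := Y'.filter fun y => a < g y + 2 ∧ g y < a + 2) (fun y hy => by
          simp only [Finset.mem_filter] at hy ⊢; simp only [hy, true_and]; omega)
      have h4 := hexlow z z' (Y'.filter fun y => g y + 2 ≤ a)
        fun y hy => hz ▸ (Finset.mem_filter.1 hy).2
      have h5 := hexhigh z z' (Y'.filter fun y => a + 2 ≤ g y)
        fun y hy => hz' ▸ (Finset.mem_filter.1 hy).2
      have h6 := (excess_mono E z z' (Y := Y'.filter fun y => a < g y + 2 ∧ g y < a + 2)
        (fun y hy => by
          simp only [Finset.mem_filter] at hy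
          obtain ⟨hy1, hy2, hy3⟩ := hy
          have h7 := hY y hy1
          have h8 : near a t = g y := by
            rw [← h7.1]; exact near_mod (by omega) (by omega)
          have h9 : near (g y) s = a := by
            rw [← hs, ha]; exact near_mod (by omega) (by omega)
          simp only [Finset.mem_filter, Finset.mem_univ, true_and, h8]
          refine ⟨⟨by omega, by omega⟩, ?_⟩
          rw [← h9]
          exact h7.2)).trans_lt hlt
      omega
    exact h1.imp (key x x' ha ha') (key x' x ha' ha)
  · exact Or.inl (hlt x' x (by omega))

/-! ### Induction on the numbers of stars -/

/-- There are bounds for good colourings of pairs of vertex sets without large induced families of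
stars. -/
def Bounded (n₁ n₂ m₁ m₂ : ℕ) : Prop :=
  ∀ k, 1 ≤ k → ∃ K U, 1 ≤ U ∧ ∀ (A : Type u) (B : Type v) (E : A → B → Prop) (X : Finset A)
    (Y : Finset B), ¬ Stars (flip E) k n₁ Y X → ¬ Stars E k n₂ X Y →
    ¬ Stars (co (flip E)) k m₁ Y X → ¬ Stars (co E) k m₂ X Y → Good E K U X Y

/-- Allows the induction step to work on finite types, where all subsets inherit freeness and
longest chains exist. Outside vertices get colour `0`, which requires `1 ≤ r`. -/
theorem Good.of_subtype {E : A → B → Prop} {K r : ℕ} (hr : 1 ≤ r) {X : Finset A} {Y : Finset B}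
    (h : Good (fun (a : X) (b : Y) => E a b) K r Finset.univ Finset.univ) : Good E K r X Y := by
  obtain ⟨f, g, hf, hg, h⟩ := h
  refine ⟨fun x => if hx : x ∈ X then f ⟨x, hx⟩ else 0, fun y => if hy : y ∈ Y then g ⟨y, hy⟩ else 0,
    fun x => ?_, fun y => ?_, fun i j => ?_⟩
  · dsimp only
    split_ifs
    exacts [hf _, hr]
  · dsimp only
    split_ifs
    exacts [hg _, hr]
  · have key : ∀ x x' : X, excess E x x'
        (Y.filter fun y => (if hy : y ∈ Y then g ⟨y, hy⟩ else 0) = j) ≤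
        excess (fun (a : X) (b : Y) => E a b) x x' (Finset.univ.filter fun y => g y = j) := by
      intro x x'
      unfold excess
      rw [← Finset.card_map (Function.Embedding.subtype (· ∈ Y))]
      refine Finset.card_le_card fun y hy => ?_
      simp only [Finset.mem_filter] at hy
      obtain ⟨⟨hy, hj⟩, hE⟩ := hy
      rw [dif_pos hy] at hj
      exact Finset.mem_map.2 ⟨⟨y, hy⟩, by simpa using ⟨hj, hE⟩, rfl⟩
    intro x hx x' hx'
    rw [Finset.mem_filter] at hx hx'
    obtain ⟨hx, hi⟩ := hx
    obtain ⟨hx', hi'⟩ := hx'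
    dsimp only at hi hi'
    rw [dif_pos hx] at hi
    rw [dif_pos hx'] at hi'
    exact (h i j ⟨x, hx⟩ (by simpa using hi) ⟨x', hx'⟩ (by simpa using hi')).imp
      (key ⟨x, hx⟩ ⟨x', hx'⟩).trans_lt (key ⟨x', hx'⟩ ⟨x, hx⟩).trans_lt

theorem Stars.of_subtype {E : A → B → Prop} {k n : ℕ} {X : Finset A} {Y : Finset B}
    (h : Stars (fun (a : X) (b : Y) => E a b) k n Finset.univ Finset.univ) : Stars E k n X Y :=
  h.map (fun a : X => a.1) (Function.Embedding.subtype (· ∈ Y)) (fun x _ => x.2) fun y _ => y.2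

theorem good_of_sharp {E : A → B → Prop} {K n m k : ℕ} (hk : 1 ≤ k)
    {X : Finset A} {Y : Finset B} (hY : NearChain (flip E) K Y X) (h₁ : ¬ Stars E k n X Y)
    (h₂ : ¬ Stars (co E) k m X Y) :
    Good E (2 * k - 1) ((n + m) * (2 * (k * K) + 1) + 2) X Y := by
  obtain ⟨f, hf⟩ := exists_sharp_colouring hk hY h₁ h₂
  refine good_of_colouring (by omega) (β := Unit) (by simp) (by simp) f (fun _ => ())
    fun i _ X' hX' Y' hY' hi _ => (hf i).mono (fun x hx => ?_) hY' le_rfl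
  exact Finset.mem_filter.2 ⟨hX' hx, hi x hx⟩

/-- The levels of largeness: the number of colours up to which the colourings are not good. -/
def level (c C : ℕ) : ℕ → ℕ
  | 0 => C
  | i + 1 => c * level c C i ^ c

theorem one_le_level {c C : ℕ} (hc : 1 ≤ c) (hC : 1 ≤ C) (i : ℕ) : 1 ≤ level c C i := by
  induction i with
  | zero => exact hC
  | succ i ih => exact Nat.mul_pos hc (Nat.pow_pos ih)

theorem level_le_succ {c C : ℕ} (hc : 1 ≤ c) (i : ℕ) :
    level c C i ≤ level c C (i + 1) :=
  calc level c C i ≤ level c C i ^ c := Nat.le_self_pow (by omega) _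
    _ ≤ c * level c C i ^ c := Nat.le_mul_of_pos_left _ hc

/-- Without two stars one side is a near-chain. If it is the tops, one colour suffices; if it is the
bottoms, the tops are coloured by `exists_sharp_colouring`. -/
theorem bounded_of_le_two {n₁ n₂ m₁ m₂ : ℕ} (h : n₁ ≤ 2 ∨ n₂ ≤ 2 ∨ m₁ ≤ 2 ∨ m₂ ≤ 2) :
    Bounded.{u, v} n₁ n₂ m₁ m₂ := by
  intro k hk
  refine ⟨2 * k - 1, (n₂ + m₂) * (2 * (k * k) + 1) + 2, by omega, ?_⟩
  intro A B E X Y h₁ h₂ h₃ h₄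
  have hchain : NearChain E k X Y → Good E (2 * k - 1) ((n₂ + m₂) * (2 * (k * k) + 1) + 2) X Y :=
    fun h => h.good.mono (by omega) (by omega) subset_rfl subset_rfl
  rcases h with h | h | h | h
  · exact good_of_sharp hk (nearChain_of_not_stars_two fun hs => h₁ (hs.mono_copies h)) h₂ h₄
  · exact hchain (nearChain_of_not_stars_two fun hs => h₂ (hs.mono_copies h))
  · exact good_of_sharp hk
      (nearChain_co.1 (nearChain_of_not_stars_two fun hs => h₃ (hs.mono_copies h))) h₂ h₄
  · exact hchain (nearChain_co.1 (nearChain_of_not_stars_two fun hs => h₄ (hs.mono_copies h)))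

/-- Failure of good colourings is a scale of largeness: each induction hypothesis, applied with the
larger leaf number `k'`, supplies one of the four families of stars in every large pair. -/
theorem Bounded.step {n₁ n₂ m₁ m₂ : ℕ} (hn₁ : 2 ≤ n₁) (hn₂ : 2 ≤ n₂) (hm₁ : 2 ≤ m₁) (hm₂ : 2 ≤ m₂)
    (h₁ : Bounded.{u, v} n₁ (n₂ + 1) (m₁ + 1) (m₂ + 1))
    (h₂ : Bounded.{u, v} (n₁ + 1) n₂ (m₁ + 1) (m₂ + 1))
    (h₃ : Bounded.{u, v} (n₁ + 1) (n₂ + 1) m₁ (m₂ + 1))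
    (h₄ : Bounded.{u, v} (n₁ + 1) (n₂ + 1) (m₁ + 1) m₂) :
    Bounded.{u, v} (n₁ + 1) (n₂ + 1) (m₁ + 1) (m₂ + 1) := by
  intro k hk
  obtain ⟨k', hk'⟩ : ∃ k', k' = 2 * (n₂ * k) := ⟨_, rfl⟩
  have hkk : k ≤ k' := by nlinarith
  obtain ⟨K₁, U₁, -, h₁⟩ := h₁ k' (by omega)
  obtain ⟨K₂, U₂, -, h₂⟩ := h₂ k' (by omega)
  obtain ⟨K₃, U₃, -, h₃⟩ := h₃ k' (by omega)
  obtain ⟨K₄, U₄, -, h₄⟩ := h₄ k' (by omega)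
  obtain ⟨c, hpow, hsq, hck⟩ : ∃ c, 2 ^ (n₂ * k') ≤ c ∧ k * k ≤ c ∧ k + 2 ≤ c :=
    ⟨max (2 ^ (n₂ * k')) (max (k * k) (k + 2)), le_max_left _ _,
      (le_max_left _ _).trans (le_max_right _ _), (le_max_right _ _).trans (le_max_right _ _)⟩
  obtain ⟨K, hK⟩ : ∃ K, K = K₁ + K₂ + K₃ + K₄ + c + 1 := ⟨_, rfl⟩
  obtain ⟨C, hC⟩ : ∃ C, C = U₁ + U₂ + U₃ + U₄ + c + 1 := ⟨_, rfl⟩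
  have hlev := one_le_level (c := c) (C := C) (by omega) (by omega)
  -- Level `51 = 3 + 16 * 3` is what yields a chain of `2 ^ 3` pairs at level `3` in
  -- `exists_positions`; the outer shape is that of `good_of_positions`.
  refine ⟨K + 2 * k, 3 * level c C 51 ^ 3,
    Nat.mul_pos (by omega) (Nat.pow_pos (hlev _)), ?_⟩
  intro A B E X Y f₁ f₂ f₃ f₄
  refine Good.of_subtype (Nat.mul_pos (by omega) (Nat.pow_pos (hlev _))) ?_
  have f₁' : ∀ X' Y', ¬ Stars (flip fun (a : X) (b : Y) => E a b) k (n₁ + 1) Y' X' :=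
    fun X' Y' hs => f₁ (hs.mono (Finset.subset_univ _) (Finset.subset_univ _)).of_subtype
  have f₂' : ∀ X' Y', ¬ Stars (fun (a : X) (b : Y) => E a b) k (n₂ + 1) X' Y' :=
    fun X' Y' hs => f₂ (hs.mono (Finset.subset_univ _) (Finset.subset_univ _)).of_subtype
  have f₃' : ∀ X' Y', ¬ Stars (co (flip fun (a : X) (b : Y) => E a b)) k (m₁ + 1) Y' X' :=
    fun X' Y' hs => f₃ (hs.mono (Finset.subset_univ _) (Finset.subset_univ _)).of_subtype
  have f₄' : ∀ X' Y', ¬ Stars (co fun (a : X) (b : Y) => E a b) k (m₂ + 1) X' Y' :=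
    fun X' Y' hs => f₄ (hs.mono (Finset.subset_univ _) (Finset.subset_univ _)).of_subtype
  generalize (fun (a : X) (b : Y) => E a b) = R at *
  have hS : Scale R k k' c n₁ n₂ m₁ m₂ fun i X Y => ¬ Good R K (level c C i) X Y :=
    { one_le := hk
      le_fat := hkk
      sq_le := hsq
      add_two_le := hck
      two_le_n₁ := hn₁
      two_le_n₂ := hn₂
      two_le_m₁ := hm₁
      two_le_m₂ := hm₂
      down := fun i X Y h hg =>
        h (hg.mono le_rfl (level_le_succ (by omega) i) subset_rfl subset_rfl)
      mono := fun i X Y X' Y' h hX hY hg => h (hg.mono le_rfl le_rfl hX hY)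
      split := fun i X Y p q hp hq h => by
        by_contra! hg
        exact h (good_of_pieces (by omega) p q hp hq hg)
      card_left := fun X Y h => by
        by_contra! hX
        exact h (good_of_card_left (by omega) (by simp only [level]; omega))
      card_right := fun X Y h => by
        by_contra! hY
        exact h ((nearChain_of_card_lt (K := K) (by omega)).good.mono le_rfl (hlev 0)
          subset_rfl subset_rfl)
      rich_n₁ := fun X Y h => by
        by_contra hs
        exact h ((h₁ _ _ R X Y hs (fun hs => f₂' _ _ (hs.mono_leaves hkk))
          (fun hs => f₃' _ _ (hs.mono_leaves hkk)) (fun hs => f₄' _ _ (hs.mono_leaves hkk))).mono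
          (by omega) (by simp only [level]; omega) subset_rfl subset_rfl)
      rich_n₂ := fun X Y h => by
        by_contra hs
        exact h ((h₂ _ _ R X Y (fun hs => f₁' _ _ (hs.mono_leaves hkk)) hs
          (fun hs => f₃' _ _ (hs.mono_leaves hkk)) (fun hs => f₄' _ _ (hs.mono_leaves hkk))).mono
          (by omega) (by simp only [level]; omega) subset_rfl subset_rfl)
      rich_m₁ := fun X Y h => by
        by_contra hs
        exact h ((h₃ _ _ R X Y (fun hs => f₁' _ _ (hs.mono_leaves hkk))
          (fun hs => f₂' _ _ (hs.mono_leaves hkk)) hs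
          (fun hs => f₄' _ _ (hs.mono_leaves hkk))).mono
          (by omega) (by simp only [level]; omega) subset_rfl subset_rfl)
      rich_m₂ := fun X Y h => by
        by_contra hs
        exact h ((h₄ _ _ R X Y (fun hs => f₁' _ _ (hs.mono_leaves hkk))
          (fun hs => f₂' _ _ (hs.mono_leaves hkk))
          (fun hs => f₃' _ _ (hs.mono_leaves hkk)) hs).mono
          (by omega) (by simp only [level]; omega) subset_rfl subset_rfl)
      free_n₁ := f₁'
      free_n₂ := f₂'
      free_m₁ := f₃'
      free_m₂ := f₄' }
  obtain ⟨f, g, hlow, hhigh, hmid⟩ := hS.exists_positions hk'.ge hpow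
  refine good_of_positions (by omega) f g hlow hhigh fun a b => ?_
  by_cases hab : a ≤ b + 1 ∧ b ≤ a + 1
  · exact not_not.1 (hmid a b _ _ hab.1 hab.2 (by simp) (by simp +contextual))
  · refine (nearChain_of_card_lt ?_).good.mono le_rfl (hlev _) subset_rfl subset_rfl
    rw [Finset.filter_false_of_mem fun y _ h => hab h.2, Finset.card_empty]
    omega

theorem bounded (n₁ n₂ m₁ m₂ : ℕ) : Bounded.{u, v} n₁ n₂ m₁ m₂ := by
  obtain ⟨s, hs⟩ : ∃ s, n₁ + n₂ + m₁ + m₂ ≤ s := ⟨_, le_rfl⟩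
  induction s generalizing n₁ n₂ m₁ m₂ with
  | zero => exact bounded_of_le_two (by omega)
  | succ s ih =>
    by_cases h : n₁ ≤ 2 ∨ n₂ ≤ 2 ∨ m₁ ≤ 2 ∨ m₂ ≤ 2
    · exact bounded_of_le_two h
    · push Not at h
      obtain ⟨h1, h2, h3, h4⟩ := h
      obtain ⟨n₁, rfl⟩ : ∃ n, n₁ = n + 1 := ⟨n₁ - 1, by omega⟩
      obtain ⟨n₂, rfl⟩ : ∃ n, n₂ = n + 1 := ⟨n₂ - 1, by omega⟩
      obtain ⟨m₁, rfl⟩ : ∃ n, m₁ = n + 1 := ⟨m₁ - 1, by omega⟩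
      obtain ⟨m₂, rfl⟩ : ∃ n, m₂ = n + 1 := ⟨m₂ - 1, by omega⟩
      exact Bounded.step (by omega) (by omega) (by omega) (by omega) (ih _ _ _ _ (by omega))
        (ih _ _ _ _ (by omega)) (ih _ _ _ _ (by omega)) (ih _ _ _ _ (by omega))

/-! ### Near-chains on both sides -/

/-- The classes of two colourings with `t` colours, up to isomorphism of the sets of colours. -/
theorem exists_fin_colouring [Fintype A] [Fintype B] {E : A → B → Prop} {K t : ℕ} (hK : 1 ≤ K)
    {α β : Type*} [Fintype α] [Fintype β] (hα : Fintype.card α ≤ t) (hβ : Fintype.card β ≤ t)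
    (f : A → α) (g : B → β)
    (h : ∀ i j X Y, (∀ x ∈ X, f x = i) → (∀ y ∈ Y, g y = j) →
      NearChain E K X Y ∧ NearChain (flip E) K Y X) :
    ∃ (f : A → Fin t) (g : B → Fin t), ∀ i j, NearChain E K (Finset.univ.filter fun x => f x = i)
      (Finset.univ.filter fun y => g y = j) ∧ NearChain (flip E) K
      (Finset.univ.filter fun y => g y = j) (Finset.univ.filter fun x => f x = i) := by
  obtain ⟨φ⟩ : Nonempty (α ↪ Fin t) := Function.Embedding.nonempty_of_card_le (by simpa using hα)
  obtain ⟨ψ⟩ : Nonempty (β ↪ Fin t) := Function.Embedding.nonempty_of_card_le (by simpa using hβ)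
  refine ⟨fun x => φ (f x), fun y => ψ (g y), fun i j => ?_⟩
  rcases (Finset.univ.filter fun x => φ (f x) = i).eq_empty_or_nonempty with hx | ⟨x, hx⟩
  · rw [hx]
    exact ⟨fun x hx => absurd hx (Finset.notMem_empty x),
      nearChain_of_card_lt (by rw [Finset.card_empty]; omega)⟩
  rcases (Finset.univ.filter fun y => ψ (g y) = j).eq_empty_or_nonempty with hy | ⟨y, hy⟩
  · rw [hy]
    exact ⟨nearChain_of_card_lt (by rw [Finset.card_empty]; omega),
      fun y hy => absurd hy (Finset.notMem_empty y)⟩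
  obtain rfl := (Finset.mem_filter.1 hx).2
  obtain rfl := (Finset.mem_filter.1 hy).2
  exact h (f x) (g y) _ _ (fun z hz => φ.injective (Finset.mem_filter.1 hz).2)
    fun z hz => ψ.injective (Finset.mem_filter.1 hz).2

/-- Good colourings have refinements, with a bounded number of colours, whose classes form near-chains
in both directions. -/
theorem exists_two_sided_colouring (n k : ℕ) (hk : 1 ≤ k) : ∃ t : ℕ,
    ∀ (A : Type u) (B : Type v) [Fintype A] [Fintype B] (E : A → B → Prop),
      ¬ Stars (flip E) k n Finset.univ Finset.univ → ¬ Stars E k n Finset.univ Finset.univ →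
      ¬ Stars (co (flip E)) k n Finset.univ Finset.univ →
      ¬ Stars (co E) k n Finset.univ Finset.univ →
      ∃ (f : A → Fin t) (g : B → Fin t), ∀ i j,
        NearChain E (2 * k - 1) (Finset.univ.filter fun x => f x = i)
          (Finset.univ.filter fun y => g y = j) ∧ NearChain (flip E) (2 * k - 1)
          (Finset.univ.filter fun y => g y = j) (Finset.univ.filter fun x => f x = i) := by
  obtain ⟨K, U, -, hU⟩ := bounded.{u, v} n n n n k hk
  refine ⟨U * ((n + n) * (2 * (k * K) + 1) + 2) ^ U +
    U * ((n + n) * (2 * (k * (2 * k - 1)) + 1) + 2) ^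
      (U * ((n + n) * (2 * (k * K) + 1) + 2) ^ U), ?_⟩
  intro A B _ _ E h₁ h₂ h₃ h₄
  obtain ⟨f, g, hf, hg, hfg⟩ := hU A B E _ _ h₁ h₂ h₃ h₄
  have hsub : ∀ {A : Type u} {B : Type v} [Fintype A] [Fintype B] {R : A → B → Prop}
    {X : Finset A} {Y : Finset B}, ¬ Stars R k n Finset.univ Finset.univ → ¬ Stars R k n X Y :=
    fun h hs => h (hs.mono (Finset.subset_univ _) (Finset.subset_univ _))
  have hsub' : ∀ {A : Type v} {B : Type u} [Fintype A] [Fintype B] {R : A → B → Prop}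
    {X : Finset A} {Y : Finset B}, ¬ Stars R k n Finset.univ Finset.univ → ¬ Stars R k n X Y :=
    fun h hs => h (hs.mono (Finset.subset_univ _) (Finset.subset_univ _))
  -- Tops are near-chains with threshold `K`, so the bottoms can be sharpened against each class of
  -- tops.
  choose G hG using fun i j => exists_sharp_colouring (E := flip E) hk (hfg i j) (hsub' h₁) (hsub' h₃)
  obtain ⟨g', hg'⟩ : ∃ g' : B → Fin U × (Fin U → Fin ((n + n) * (2 * (k * K) + 1) + 2)),
      g' = fun y => ((⟨g y, hg y⟩ : Fin U), fun i : Fin U => G i (g y) y) := ⟨_, rfl⟩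
  have hY : ∀ (i : Fin U) j, NearChain (flip E) (2 * k - 1) (Finset.univ.filter fun y => g' y = j)
      (Finset.univ.filter fun x => f x = i) := by
    rintro i ⟨j, ψ⟩
    refine (hG i j (ψ i)).mono (fun y hy => ?_) subset_rfl le_rfl
    have h1 := (Finset.mem_filter.1 hy).2
    rw [hg', Prod.mk.injEq] at h1
    obtain ⟨rfl, rfl⟩ := h1
    simp
  -- Now the bottoms have threshold `2 * k - 1`, and the tops are sharpened against each refined
  -- class of bottoms; shrinking classes of tops preserves what was gained for the bottoms.
  choose F hF using fun i j => exists_sharp_colouring hk (hY i j) (hsub h₂) (hsub h₄)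
  have hdisj : ∀ x i j φ, ((⟨f x, hf x⟩, fun j => F ⟨f x, hf x⟩ j x) :
      Fin U × (Fin U × (Fin U → Fin ((n + n) * (2 * (k * K) + 1) + 2)) →
        Fin ((n + n) * (2 * (k * (2 * k - 1)) + 1) + 2))) = (i, φ) → f x = i ∧ F i j x = φ j := by
    intro x i j φ h
    rw [Prod.mk.injEq] at h
    obtain ⟨rfl, rfl⟩ := h
    exact ⟨rfl, rfl⟩
  refine exists_fin_colouring (by omega) (α := Fin U × (Fin U × (Fin U →
    Fin ((n + n) * (2 * (k * K) + 1) + 2)) → Fin ((n + n) * (2 * (k * (2 * k - 1)) + 1) + 2)))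
    (by simp) (by simp) (fun x => (⟨f x, hf x⟩, fun j => F ⟨f x, hf x⟩ j x)) g' ?_
  rintro ⟨i, φ⟩ j X Y hX' hY'
  refine ⟨(hF i j (φ j)).mono (fun x hx => ?_) (fun y hy => ?_) le_rfl,
    (hY i j).mono (fun y hy => ?_) (fun x hx => ?_) le_rfl⟩
  · have h1 := hdisj x i j φ (hX' x hx)
    exact Finset.mem_filter.2 ⟨Finset.mem_filter.2 ⟨Finset.mem_univ _, h1.1⟩, h1.2⟩
  · exact Finset.mem_filter.2 ⟨Finset.mem_univ _, hY' y hy⟩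
  · exact Finset.mem_filter.2 ⟨Finset.mem_univ _, hY' y hy⟩
  · exact Finset.mem_filter.2 ⟨Finset.mem_univ _, (hdisj x i j φ (hX' x hx)).1⟩

/-! ### Translation to bipartite graphs -/

/-- A leaf is needed to distinguish the centres, which is where `1 ≤ k` enters. -/
theorem IsFrame.exists_embeddings {E : A → B → Prop} {k n : ℕ} {X : Finset A} {Y : Finset B}
    {a : Fin n → A} {P : Fin n → Finset B} (h : IsFrame E k n X Y a P) (hk : 1 ≤ k) :
    ∃ (f : Fin n × Unit ↪ A) (g : Fin n × Fin k ↪ B), ∀ c d, E (f c) (g d) ↔ c.1 = d.1 := by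
  have hadj : ∀ i j, ∀ y ∈ P j, E (a i) y ↔ i = j := fun i j y hy =>
    ⟨fun hE => by_contra fun hij => h.not_adj j i (Ne.symm hij) y hy hE,
      fun hij => hij ▸ h.adj j y hy⟩
  have hP : ∀ i (l : Fin k), (((P i).equivFinOfCardEq (h.card i)).symm l : B) ∈ P i :=
    fun i l => Subtype.property _
  refine ⟨⟨fun c => a c.1, ?_⟩, ⟨fun d => ((P d.1).equivFinOfCardEq (h.card d.1)).symm d.2, ?_⟩,
    fun c d => hadj _ _ _ (hP _ _)⟩
  · rintro ⟨i, _⟩ ⟨j, _⟩ (hij : a i = a j)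
    have h1 := (hadj i i _ (hP i ⟨0, hk⟩)).2 rfl
    rw [hij, hadj _ _ _ (hP i ⟨0, hk⟩)] at h1
    rw [h1]
  · rintro ⟨i, l⟩ ⟨j, m⟩ hij
    simp only at hij
    have h1 := (hadj i i _ (hP i l)).2 rfl
    rw [hij, hadj _ _ _ (hP j m)] at h1
    subst h1
    simpa using hij

/-- Adjacency as a relation. -/
def Rel (G : BipartiteGraph A B) : A → B → Prop := fun a b => (a, b) ∈ G.edges

theorem contains_starΛ_of_stars {G : BipartiteGraph A B} {k n : ℕ} (hk : 1 ≤ k) {X : Finset A}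
    {Y : Finset B} (h : Stars G.Rel k n X Y) : G.Contains (copies n (starΛ k)) := by
  obtain ⟨a, P, h⟩ := h.exists_isFrame
  obtain ⟨f, g, h⟩ := h.exists_embeddings hk
  exact ⟨f, g, fun c d => (h c d).trans (by simp [copies, starΛ])⟩

theorem contains_starV_of_stars {G : BipartiteGraph A B} {k n : ℕ} (hk : 1 ≤ k) {X : Finset A}
    {Y : Finset B} (h : Stars (flip G.Rel) k n Y X) : G.Contains (copies n (starV k)) := by
  obtain ⟨a, P, h⟩ := h.exists_isFrame
  obtain ⟨f, g, h⟩ := h.exists_embeddings hk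
  exact ⟨g, f, fun c d => (h d c).trans (by simp [copies, starV, eq_comm])⟩

theorem Contains.of_bipCompl {G : BipartiteGraph A B} {H : BipartiteGraph C D}
    (h : G.bipCompl.Contains H) : G.Contains H.bipCompl := by
  obtain ⟨f, g, h⟩ := h
  exact ⟨f, g, fun c d => (not_iff_comm.1 (h c d)).symm⟩

/-- In two disjoint stars the `K` leaves of each centre are missed by the other, so both excesses
are at least `K`. -/
theorem induce_free_starΛ {G : BipartiteGraph A B} {K : ℕ} {X : Finset A} {Y : Finset B}
    (h : NearChain G.Rel K X Y) {S : Set A} {T : Set B} (hS : ∀ x ∈ S, x ∈ X) (hT : ∀ y ∈ T, y ∈ Y) :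
    (G.induce S T).Free (copies 2 (starΛ K)) := by
  rintro ⟨f, g, hfg⟩
  have key : ∀ i j : Fin 2, i ≠ j → K ≤ excess G.Rel (f (i, ())).1 (f (j, ())).1 Y := by
    intro i j hij
    have h1 : (Finset.univ.map ⟨fun l : Fin K => (g (i, l)).1, fun l m hlm => by
        simpa using g.injective (Subtype.ext hlm)⟩ : Finset B) ⊆
        Y.filter fun y => G.Rel (f (i, ())).1 y ∧ ¬ G.Rel (f (j, ())).1 y := by
      intro y hy
      obtain ⟨l, -, rfl⟩ := Finset.mem_map.1 hy
      refine Finset.mem_filter.2 ⟨hT _ (g (i, l)).2, ?_, fun hE => ?_⟩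
      · exact (hfg (i, ()) (i, l)).2 ⟨rfl, trivial⟩
      · exact hij ((hfg (j, ()) (i, l)).1 hE).1.symm
    simpa [excess] using Finset.card_le_card h1
  rcases h _ (hS _ (f (0, ())).2) _ (hS _ (f (1, ())).2) with h | h
  · exact absurd (key 0 1 (by decide)) (by omega)
  · exact absurd (key 1 0 (by decide)) (by omega)

theorem induce_free_starV {G : BipartiteGraph A B} {K : ℕ} {X : Finset A} {Y : Finset B}
    (h : NearChain (flip G.Rel) K Y X) {S : Set A} {T : Set B} (hS : ∀ x ∈ S, x ∈ X)
    (hT : ∀ y ∈ T, y ∈ Y) : (G.induce S T).Free (copies 2 (starV K)) := by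
  rintro ⟨f, g, hfg⟩
  refine induce_free_starΛ (G := ⟨{p | G.Rel p.2 p.1}⟩) h hT hS ⟨g, f, fun c d => ?_⟩
  exact (hfg d c).trans (by simp [copies, starΛ, starV, eq_comm])

theorem isIndexedPartition_fibres {X : Type u} {t : ℕ} (f : X → Fin t) :
    IsIndexedPartition fun i => {x | f x = i} :=
  ⟨fun _ _ hij => Set.disjoint_left.2 fun _ hi hj => hij (hi.symm.trans hj),
    Set.eq_univ_of_forall fun x => Set.mem_iUnion.2 ⟨f x, rfl⟩⟩

end BipartiteGraph

end

theorem mainTheorem4 :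
    ∃ U : ℕ → ℕ → ℕ, ∀ (k n' n'' m' m'' : ℕ), 1 ≤ k →
      ∀ (A : Type u) (B : Type v) [Finite A] [Finite B] (G : BipartiteGraph A B),
        G.Free (BipartiteGraph.copies n' (BipartiteGraph.starV k)) →
        G.Free (BipartiteGraph.copies n'' (BipartiteGraph.starΛ k)) →
        G.Free (BipartiteGraph.copies m' (BipartiteGraph.starV k)).bipCompl →
        G.Free (BipartiteGraph.copies m'' (BipartiteGraph.starΛ k)).bipCompl →
        ∃ t : ℕ, t ≤ U (n' + n'' + m' + m'') k ∧
          ∃ (P : Fin t → Set A) (Q : Fin t → Set B),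
            IsIndexedPartition P ∧ IsIndexedPartition Q ∧
            ∀ i j : Fin t,
              (G.induce (P i) (Q j)).Free
                (BipartiteGraph.copies 2 (BipartiteGraph.starΛ (2 * k - 1))) ∧
              (G.induce (P i) (Q j)).Free
                (BipartiteGraph.copies 2 (BipartiteGraph.starV (2 * k - 1))) := by
  choose U hU using BipartiteGraph.exists_two_sided_colouring.{u, v}
  -- The value at `k = 0` is irrelevant. For `k ≥ 1`, all four star numbers are raised to their sum,
  -- since a larger family of stars contains the smaller ones.
  refine ⟨fun n k => if hk : 1 ≤ k then U n k hk else 0, ?_⟩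
  intro k n' n'' m' m'' hk A B _ _ G h₁ h₂ h₃ h₄
  have := Fintype.ofFinite A
  have := Fintype.ofFinite B
  obtain ⟨f, g, hfg⟩ := hU (n' + n'' + m' + m'') k hk A B G.Rel
    (fun hs => h₁ (BipartiteGraph.contains_starV_of_stars hk (hs.mono_copies (by omega))))
    (fun hs => h₂ (BipartiteGraph.contains_starΛ_of_stars hk (hs.mono_copies (by omega))))
    (fun hs => h₃ (BipartiteGraph.contains_starV_of_stars (G := G.bipCompl) hk
      (hs.mono_copies (by omega))).of_bipCompl)
    (fun hs => h₄ (BipartiteGraph.contains_starΛ_of_stars (G := G.bipCompl) hk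
      (hs.mono_copies (by omega))).of_bipCompl)
  refine ⟨_, (dif_pos hk).ge, fun i => {x | f x = i}, fun j => {y | g y = j},
    BipartiteGraph.isIndexedPartition_fibres f, BipartiteGraph.isIndexedPartition_fibres g,
    fun i j => ⟨BipartiteGraph.induce_free_starΛ (hfg i j).1 ?_ ?_,
      BipartiteGraph.induce_free_starV (hfg i j).2 ?_ ?_⟩⟩ <;> simp
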